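/- Let $n\ge 0$ and $[n]=\{1,\dots,n\}$. **Threshold functions.** A boolean function $f:\{0,1\}^n\to\{0,1\}$ is a linear threshold function (LTF) if it has a realization, i.e. a pair $(\vec w,\theta)\in\mathbb Q^n\times\mathbb Q$ such that $f(\vec x)=1$ exactly when $\vec w\cdot\vec x>\theta$. It is *positive* if it has a realization with all $w_i>0$, *small* if it has a realization with all $w_i\le\theta$, and *ample* if it has a realization with $\sum_i w_i>2\theta$. An LTF is *Semi-Goldilocks* if it is positive and small, and *Goldilocks* if it is also ample. Let $\mathrm{Gold}_{g_+}(n)$ and $\mathrm{Gold}_0(n)$ be the numbers of Semi-Goldilocks and of Goldilocks functions of $n$ variables. **Duality and SD classes.** The dual of $f$ is $f^d(\vec x)=\overline{f(\overline{\vec x})}$, where a bar denotes negation; $f$ is self-dual if $f=f^d$. The self-dualization of $f$ is the function of $n+1$ variables $\overline{x_0}\,f(x_1,\dots,x_n)+x_0\,f^d(x_1,\dots,x_n)$; the anti-self-dualization of a self-dual $F$ in variables $x_0,\dots,x_n$ is $F(0,x_1,\dots,x_n)$. Two boolean functions are in the same SD class if one is transformed into the other by a sequence of permutations of the arguments, negations,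 self-dualizations and anti-self-dualizations. The Chow parameters of $f$ are $(m,\vec a)$, with $m$ the number of true vectors and $\vec a=\sum_{f(\vec x)=1}\vec x+\sum_{f(\vec x)=0}\overline{\vec x}$. **Canonical generators.** A canonical generator on $n+1$ variables $x_0,\dots,x_n$ is a positive self-dual LTF $f$ whose Chow parameters are in monotonic order; these parameters are then of the form $(2^n,2a_0,\dots,2a_n)$ with integers $a_i$, and we write $\vec a=(a_0,\dots,a_n)$. An *enumeration of canonical generators for $n$* (an output of Winder's algorithm) is a finite set $G$ of canonical generators on $n+1$ variables that contains exactly one member of every SD class containing an LTF of $n$ variables, and no member of any other SD class. **Algorithm 1.** For $0\le i\le n$ and $s\in\{0,1\}$ let $f_{x_i=s}$ be the function of $n$ variables obtained from $f$ by setting $x_i=s$. Let $\mathrm{isSmall}(f,i,s)$ test whether $f_{x_i=s}$ vanishes at all $n$ standard basis vectors. Let $\mathrm{PermCount}(f,i,s,\vec a)=n!/\prod_v\mu_v!$, where $v$ runs over the distinct values among the $a_j$ with $j\ne i$ and $\mu_v$ is the number of $j\neq i$ with $a_j=v$. Call $i$ *new* if $i=0$ or $a_i\ne a_{i-1}$.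 * $\mathrm{SGoldSD}(f,\vec a)$ is the sum, over all new $i$, of $\mathrm{PermCount}(f,i,1,\vec a)$ if $\mathrm{isSmall}(f,i,1)$ holds, plus $\mathrm{PermCount}(f,i,0,\vec a)$ if $\mathrm{isSmall}(f,i,0)$ holds and $a_i\neq 2^{n-1}$. * $\mathrm{GoldSD}(f,\vec a)$ is the sum, over all new $i$, of $\mathrm{PermCount}(f,i,s_i,\vec a)$ if $\mathrm{isSmall}(f,i,s_i)$ holds, where $s_i=1$ if $a_i>2^{n-1}$ and $s_i=0$ otherwise. **Chambers.** For an integer $g\ge0$ let $\mathcal D_{g,n}=\{\vec w\in\mathbb R^n: 0<w_j\le1\ \forall j,\ \sum_j w_j>2-2g\}$. Its chambers are the connected components of the complement in $\mathcal D_{g,n}$ of all the walls $\sum_{j\in S}w_j=1$, $\emptyset\ne S\subseteq[n]$. **Theorem.** The set of all canonical generators on $n+1$ variables with nondecreasing Chow parameters $a_0\le\dots\le a_n$ is an enumeration of canonical generators for $n$, and so is the set of those with nonincreasing Chow parameters. For every enumeration $G$ of canonical generators for $n$: 1. for all $f\in G$, $i$ and $s$, the Chow parameters of $f$ are indeed of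 the form $(2^n,2\vec a)$ with $\vec a$ integral, $\mathrm{isSmall}(f,i,s)$ holds if and only if $f_{x_i=s}$ is small, and $\mathrm{PermCount}(f,i,s,\vec a)$ is the number of distinct functions obtained from $f_{x_i=s}$ by permuting its arguments; 2. $\displaystyle\sum_{f\in G}\mathrm{SGoldSD}(f,\vec a)=\mathrm{Gold}_{g_+}(n)$ and $\displaystyle\sum_{f\in G}\mathrm{GoldSD}(f,\vec a)=\mathrm{Gold}_0(n)$; 3. if $n\ge1$, then $\sum_{f\in G}\mathrm{SGoldSD}(f,\vec a)$ is the number of chambers of $\mathcal D_{g,n}$ for every $g\ge1$, and $\sum_{f\in G}\mathrm{GoldSD}(f,\vec a)$ is the number of chambers of $\mathcal D_{0,n}$. -/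

import Mathlib

namespace LTF

/-! ### Boolean functions and linear threshold functions -/

/-- Boolean functions of `n` variables. -/
abbrev BoolFn (n : ℕ) : Type := (Fin n → Bool) → Bool

/-- `(w, θ)` is a realization of `f`, i.e. `f x = sgn (w · x - θ)`, where `sgn` is `1` on positive
arguments and `0` on nonpositive ones. -/
def Realizes {n : ℕ} (w : Fin n → ℚ) (θ : ℚ) (f : BoolFn n) : Prop :=
  ∀ x : Fin n → Bool, f x = decide (0 < (∑ i, w i * (if x i then 1 else 0)) - θ)

/-- `f` is a linear threshold function. -/
def IsLTF {n : ℕ} (f : BoolFn n) : Prop := ∃ w θ, Realizes w θ f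

/-- Positivity. -/
def IsPositive {n : ℕ} (f : BoolFn n) : Prop :=
  ∃ w θ, Realizes w θ f ∧ ∀ i, 0 < w i

/-- Smallness. -/
def IsSmall {n : ℕ} (f : BoolFn n) : Prop :=
  ∃ w θ, Realizes w θ f ∧ ∀ i, w i ≤ θ

/-- Ampleness. -/
def IsAmple {n : ℕ} (f : BoolFn n) : Prop :=
  ∃ w θ, Realizes w θ f ∧ 2 * θ < ∑ i, w i

/-- Semi-Goldilocks functions. -/
def IsSemiGoldilocks {n : ℕ} (f : BoolFn n) : Prop :=
  IsLTF f ∧ IsPositive f ∧ IsSmall f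

/-- Goldilocks functions. -/
def IsGoldilocks {n : ℕ} (f : BoolFn n) : Prop :=
  IsSemiGoldilocks f ∧ IsAmple f

/-- The number of Semi-Goldilocks functions of `n` variables. -/
noncomputable def numSemiGoldilocks (n : ℕ) : ℕ := {f : BoolFn n | IsSemiGoldilocks f}.ncard

/-- The number of Goldilocks functions of `n` variables. -/
noncomputable def numGoldilocks (n : ℕ) : ℕ := {f : BoolFn n | IsGoldilocks f}.ncard

/-! ### Duality, SD classes, Chow parameters -/

/-- The dual function `x ↦ ¬ f (¬ x)`. -/
def dual {n : ℕ} (f : BoolFn n) : BoolFn n := fun x => !f (fun i => !x i)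

/-- Self-dual functions. -/
def IsSelfDual {n : ℕ} (f : BoolFn n) : Prop := dual f = f

/-- Permutation of the arguments. -/
def permute {n : ℕ} (σ : Equiv.Perm (Fin n)) (f : BoolFn n) : BoolFn n := fun x => f (x ∘ σ)

/-- Complementation by `u`: the arguments `x i` with `u i = 1` are negated. -/
def complement {n : ℕ} (u : Fin n → Bool) (f : BoolFn n) : BoolFn n :=
  fun x => f (fun i => xor (u i) (x i))

/-- Self-dualization `¬ x₀ f (x₁, …, xₙ) + x₀ fᵈ (x₁, …, xₙ)`. -/
def selfDualize {n : ℕ} (f : BoolFn n) : BoolFn (n + 1) :=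
  fun x => if x 0 then dual f (Fin.tail x) else f (Fin.tail x)

/-- Anti-self-dualization `F (0, x₁, …, xₙ)`. -/
def antiSelfDualize {n : ℕ} (F : BoolFn (n + 1)) : BoolFn n := fun x => F (Fin.cons false x)

/-- One elementary transformation: a permutation of the arguments, a negation (of some of the
arguments, or of the value), a self-dualization, or the anti-self-dualization of a self-dual
function. -/
inductive SDStep : (Σ n, BoolFn n) → (Σ n, BoolFn n) → Prop
  | perm {n : ℕ} (σ : Equiv.Perm (Fin n)) (f : BoolFn n) : SDStep ⟨n, f⟩ ⟨n, permute σ f⟩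
  | compl {n : ℕ} (u : Fin n → Bool) (f : BoolFn n) : SDStep ⟨n, f⟩ ⟨n, complement u f⟩
  | neg {n : ℕ} (f : BoolFn n) : SDStep ⟨n, f⟩ ⟨n, fun x => !f x⟩
  | sd {n : ℕ} (f : BoolFn n) : SDStep ⟨n, f⟩ ⟨n + 1, selfDualize f⟩
  | antisd {n : ℕ} (F : BoolFn (n + 1)) (hF : IsSelfDual F) :
      SDStep ⟨n + 1, F⟩ ⟨n, antiSelfDualize F⟩

/-- `f` and `h` (possibly with different numbers of variables) lie in the same SD class. -/
def SameSDClass {m n : ℕ} (f : BoolFn m) (h : BoolFn n) : Prop :=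
  Relation.ReflTransGen SDStep ⟨m, f⟩ ⟨n, h⟩

/-- The Chow parameter `m_f`, the number of true vectors. -/
def chowZero {n : ℕ} (f : BoolFn n) : ℕ := (Finset.univ.filter fun x => f x = true).card

/-- The vector of Chow parameters `∑_{x true} x + ∑_{x false} (¬ x)`. -/
def chow {n : ℕ} (f : BoolFn n) (i : Fin n) : ℕ :=
  (∑ x ∈ Finset.univ.filter (fun x => f x = true), (x i).toNat) +
    ∑ x ∈ Finset.univ.filter (fun x => f x = false), (!x i).toNat

/-! ### Canonical generators -/

/-- Canonical generators of SD classes: positive self-dual linear threshold functions whose Chow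
parameters are in monotonic order (nondecreasing or nonincreasing). -/
def IsCanonicalGenerator {n : ℕ} (f : BoolFn n) : Prop :=
  IsLTF f ∧ IsPositive f ∧ IsSelfDual f ∧ (Monotone (chow f) ∨ Antitone (chow f))

/-- `G` is an output of the canonical enumeration for `n` variables: it consists of canonical
generators of `n + 1` variables, exactly one in each SD class which contains linear threshold
functions of `n` variables (and none in other classes). -/
structure IsGeneratorEnumeration (n : ℕ) (G : Finset (BoolFn (n + 1))) : Prop where
  canonical : ∀ f ∈ G, IsCanonicalGenerator f
  meets : ∀ f ∈ G, ∃ h : BoolFn n, IsLTF h ∧ SameSDClass f h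
  existsUnique : ∀ h : BoolFn n, IsLTF h → ∃! f, f ∈ G ∧ SameSDClass f h

open Classical in
/-- All canonical generators of `n + 1` variables with nondecreasing Chow parameters. -/
noncomputable def monotoneGenerators (n : ℕ) : Finset (BoolFn (n + 1)) :=
  Finset.univ.filter fun f => IsCanonicalGenerator f ∧ Monotone (chow f)

open Classical in
/-- All canonical generators of `n + 1` variables with nonincreasing Chow parameters. -/
noncomputable def antitoneGenerators (n : ℕ) : Finset (BoolFn (n + 1)) :=
  Finset.univ.filter fun f => IsCanonicalGenerator f ∧ Antitone (chow f)

/-! ### The algorithm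

Its input is a function `f` of the `n + 1` variables `x₀, …, xₙ` with Chow parameters
`(2 ^ n, 2 * a₀, …, 2 * aₙ)`, together with the vector `a = (a₀, …, aₙ)`. -/

/-- The vector `a` for which `f` has Chow parameters `(2 ^ n, 2 * a₀, …, 2 * aₙ)`
(for self-dual `f` the division is exact). -/
def halfChow {n : ℕ} (f : BoolFn (n + 1)) (i : Fin (n + 1)) : ℕ := chow f i / 2

/-- The reduction `f_{x_i = s}`. -/
def reduction {n : ℕ} (f : BoolFn (n + 1)) (i : Fin (n + 1)) (s : Bool) : BoolFn n :=
  fun x => f (i.insertNth s x)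

/-- The test `isSmall (f, i, s)`: `f_{x_i = s}` vanishes at all standard basis vectors. -/
def isSmallTest {n : ℕ} (f : BoolFn (n + 1)) (i : Fin (n + 1)) (s : Bool) : Bool :=
  decide (∀ j : Fin n, reduction f i s (fun k => decide (k = j)) = false)

open Nat in
/-- The subroutine `PermCount (f, i, s, a)`, which depends only on `a` and `i`: `n !` divided by
the product of `μ !` over the multiplicities `μ` of the distinct values among the `a_j`, `j ≠ i`. -/
def permCount {n : ℕ} (a : Fin (n + 1) → ℕ) (i : Fin (n + 1)) : ℕ :=
  n ! / ∏ v ∈ (Finset.univ.erase i).image a, ((Finset.univ.erase i).filter fun j => a j = v).card !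

/-- The test "`a_i ≠ a_{i-1}`", which holds for `i = 0`, where there is no previous index. -/
def IsNew {n : ℕ} (a : Fin (n + 1) → ℕ) (i : Fin (n + 1)) : Prop :=
  ∀ j : Fin (n + 1), j.val + 1 = i.val → a i ≠ a j

instance {n : ℕ} (a : Fin (n + 1) → ℕ) (i : Fin (n + 1)) : Decidable (IsNew a i) :=
  inferInstanceAs (Decidable (∀ j : Fin (n + 1), j.val + 1 = i.val → a i ≠ a j))

/-- The procedure `SGoldSD (f, a)`. The test `a_i ≠ 2 ^ (n - 1)` is written `2 * a_i ≠ 2 ^ n`. -/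
def sGoldSD {n : ℕ} (f : BoolFn (n + 1)) (a : Fin (n + 1) → ℕ) : ℕ :=
  ∑ i, if IsNew a i then
      (if isSmallTest f i true = true then permCount a i else 0) +
        (if isSmallTest f i false = true ∧ 2 * a i ≠ 2 ^ n then permCount a i else 0)
    else 0

/-- The procedure `GoldSD (f, a)`. The test `a_i > 2 ^ (n - 1)` is written `2 ^ n < 2 * a_i`; the
reduction which is examined is `f_{x_i = 1}` if it holds and `f_{x_i = 0}` otherwise. -/
def goldSD {n : ℕ} (f : BoolFn (n + 1)) (a : Fin (n + 1) → ℕ) : ℕ :=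
  ∑ i, if IsNew a i then
      (if isSmallTest f i (decide (2 ^ n < 2 * a i)) = true then permCount a i else 0)
    else 0

/-! ### Chambers -/

/-- The space `𝓓_{g,n}` of admissible weights. -/
def admissibleWeights (g n : ℕ) : Set (Fin n → ℝ) :=
  {w | (∀ j, 0 < w j ∧ w j ≤ 1) ∧ 2 - 2 * (g : ℝ) < ∑ j, w j}

/-- The union of the walls of the fine chamber decomposition. -/
def walls (n : ℕ) : Set (Fin n → ℝ) :=
  {w | ∃ S : Finset (Fin n), S.Nonempty ∧ ∑ j ∈ S, w j = 1}

/-- The number of chambers of `𝓓_{g,n}`: the number of connected components of the complement of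
the walls in `𝓓_{g,n}`. -/
noncomputable def numChambers (g n : ℕ) : ℕ :=
  Nat.card (ConnectedComponents ↥(admissibleWeights g n \ walls n))

end LTF

open LTF

/-!
Every Semi-Goldilocks function `h` is completed to a self-dual function of one more variable `x₀`,
by prescribing that its reduction at `x₀ = 0` or at `x₀ = 1` be `h`. In terms of a realization
`(w, θ)` the new weight is `2 θ - ∑ w` in the first case and `∑ w - 2 θ` in the second
(`Realizes.selfDualLift`). So the lift at `x₀ = 1` is positive if `h` is ample, and the lift at
`x₀ = 0` is positive if it is not. Conversely all reductions of a positive self-dual threshold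
function at `x_i = 1` are ample (`IsPositive.isAmple_reduction_true`), whereas the reduction at
`x_i = 0` is ample only if the function does not depend on `x_i`
(`IsPositive.isAmple_reduction_false_iff`), which is the case exactly if `a_i = 2 ^ (n - 1)`.
Smallness of a positive function is a condition on its values at the standard basis vectors.

Two facts govern the rest. Chow's theorem (`IsLTF.eq_of_coef_eq`) says that a self-dual threshold
function is determined by its Chow parameters, so its symmetries are the permutations which preserve
these; this yields the orbit sizes computed by `PermCount` (`permCount_eq`). Secondly, the multiset
of the nonzero absolute values of the average and of the degree-one Fourier coefficients, which are
affine in the Chow parameters, is an invariant of SD classes (`SameSDClass.chowSpectrum_eq`). Hence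
positive self-dual threshold functions of equally many variables in one SD class differ by a
permutation of the arguments (`SameSDClass.exists_permute_eq`); sorting the Chow parameters makes
the representative unique. It follows that each orbit of Semi-Goldilocks functions arises from
exactly one generator and one block of equal Chow parameters (`ncard_eq_sum_permCount`).

For the chambers, the function `x ↦ [w · x > 1]` is locally constant in `w` off the walls, with
convex fibres (`numChambers_eq_ncard`), and by density of the rational points its values are exactly
the functions to be counted.
-/

namespace LTF

open Filter Topology

variable {n : ℕ}

/-! ### Realizations -/

/-- The scalar product `w · x` of a weight vector with a boolean vector. -/
def dot (w : Fin n → ℚ) (x : Fin n → Bool) : ℚ := ∑ i, w i * (if x i then 1 else 0)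

lemma realizes_iff {w : Fin n → ℚ} {θ : ℚ} {f : BoolFn n} :
    Realizes w θ f ↔ ∀ x, f x = true ↔ θ < dot w x := by
  simp only [Realizes, dot]
  refine forall_congr' fun x => ?_
  rw [← sub_pos (b := θ), Bool.eq_iff_iff, decide_eq_true_iff]

lemma dot_add (v w : Fin n → ℚ) (x : Fin n → Bool) : dot (v + w) x = dot v x + dot w x := by
  simp only [dot, Pi.add_apply, add_mul, Finset.sum_add_distrib]

lemma dot_smul (c : ℚ) (w : Fin n → ℚ) (x : Fin n → Bool) : dot (c • w) x = c * dot w x := by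
  simp only [dot, Pi.smul_apply, smul_eq_mul, Finset.mul_sum, mul_assoc]

lemma dot_not (w : Fin n → ℚ) (x : Fin n → Bool) :
    dot w (fun i => !x i) = ∑ i, w i - dot w x := by
  rw [dot, dot, ← Finset.sum_sub_distrib]
  refine Finset.sum_congr rfl fun i _ => ?_
  cases x i <;> simp

lemma dot_single (w : Fin n → ℚ) (j : Fin n) : dot w (fun k => decide (k = j)) = w j := by
  simp [dot]

lemma dot_insertNth (w : Fin (n + 1) → ℚ) (i : Fin (n + 1)) (s : Bool) (x : Fin n → Bool) :
    dot w (i.insertNth s x) = w i * (if s then 1 else 0) + dot (fun j => w (i.succAbove j)) x := by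
  simp [dot, Fin.sum_univ_succAbove _ i]

lemma dot_mono {w : Fin n → ℚ} (hw : ∀ i, 0 ≤ w i) {x y : Fin n → Bool} (hxy : x ≤ y) :
    dot w x ≤ dot w y := by
  refine Finset.sum_le_sum fun i _ => mul_le_mul_of_nonneg_left ?_ (hw i)
  have := hxy i
  revert this
  cases x i <;> cases y i <;> simp

/-- The threshold of a realization may be raised a little, in such a way that no boolean vector
lies on the separating hyperplane. -/
lemma Realizes.exists_strict {w : Fin n → ℚ} {θ η : ℚ} {f : BoolFn n} (h : Realizes w θ f)
    (hη : θ < η) :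
    ∃ θ', θ < θ' ∧ θ' < η ∧ Realizes w θ' f ∧ ∀ x, dot w x ≠ θ' := by
  rw [realizes_iff] at h
  have h1 : ∀ᶠ t in 𝓝[>] θ, ∀ x, f x = true → t < dot w x := by
    refine eventually_all.2 fun x => ?_
    by_cases hx : f x = true
    · have : ∀ᶠ t in 𝓝[>] θ, t < dot w x :=
        nhdsWithin_le_nhds (eventually_lt_nhds ((h x).1 hx))
      exact this.mono fun t ht _ => ht
    · exact Eventually.of_forall fun t ht => absurd ht hx
  obtain ⟨t, ht, hθ, hη'⟩ := (h1.and (Ioo_mem_nhdsGT hη)).exists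
  have h2 : ∀ x, f x = true ∨ dot w x < t := fun x => by
    by_cases hx : f x = true
    · exact Or.inl hx
    · exact Or.inr ((not_lt.1 fun h' => hx ((h x).2 h')).trans_lt hθ)
  refine ⟨t, hθ, hη', realizes_iff.2 fun x => ⟨ht x, fun h' => (h x).2 (hθ.trans h')⟩,
    fun x => ?_⟩
  rcases h2 x with hx | hx
  · exact (ht x hx).ne'
  · exact hx.ne

lemma IsPositive.isLTF {f : BoolFn n} (hf : IsPositive f) : IsLTF f := by
  obtain ⟨w, θ, h, -⟩ := hf
  exact ⟨w, θ, h⟩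

lemma IsPositive.monotone {f : BoolFn n} (hf : IsPositive f) : Monotone f := by
  obtain ⟨w, θ, h, hw⟩ := hf
  rw [realizes_iff] at h
  intro x y hxy
  rw [Bool.le_iff_imp, h, h]
  exact fun h' => h'.trans_le (dot_mono (fun i => (hw i).le) hxy)

/-- Every linear threshold function becomes positive after the negation of suitable arguments. -/
lemma IsLTF.exists_complement_isPositive {f : BoolFn n} (hf : IsLTF f) :
    ∃ u, IsPositive (complement u f) := by
  obtain ⟨w, θ, h⟩ := hf
  obtain ⟨θ, -, -, h, hne⟩ := h.exists_strict (lt_add_one θ)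
  rw [realizes_iff] at h
  -- Vanishing weights are replaced by a small positive number.
  let v : ℚ → Fin n → ℚ := fun ε i => if w i = 0 then ε else w i
  have hv0 : v 0 = w := by
    funext i
    simp only [v]
    split_ifs with hi <;> simp [hi]
  have hcont : ∀ x, Tendsto (fun ε => dot (v ε) x) (𝓝[>] 0) (𝓝 (dot w x)) := fun x => by
    have : Continuous fun ε => dot (v ε) x := by
      refine continuous_finsetSum _ fun i _ => Continuous.mul ?_ continuous_const
      by_cases hi : w i = 0
      · simp only [v, hi, if_true]
        exact continuous_id'
      · simpa [v, hi] using continuous_const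
    have := this.tendsto 0
    rw [hv0] at this
    exact this.mono_left nhdsWithin_le_nhds
  have hev : ∀ᶠ ε in 𝓝[>] (0 : ℚ), ∀ x, f x = true ↔ θ < dot (v ε) x := by
    refine eventually_all.2 fun x => ?_
    by_cases hx : θ < dot w x
    · exact ((hcont x).eventually (eventually_gt_nhds hx)).mono fun ε hε =>
        ⟨fun _ => hε, fun _ => (h x).2 hx⟩
    · have hlt : dot w x < θ := lt_of_le_of_ne (not_lt.1 hx) (hne x)
      exact ((hcont x).eventually (eventually_lt_nhds hlt)).mono fun ε hε =>
        ⟨fun h' => absurd ((h x).1 h') hx, fun h' => absurd h' hε.not_gt⟩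
  obtain ⟨ε, hε, hε0⟩ := (hev.and self_mem_nhdsWithin).exists
  have hεv : ∀ i, v ε i ≠ 0 := fun i => by
    simp only [v]
    split_ifs with hi
    · exact (ne_of_gt hε0)
    · exact hi
  refine ⟨fun i => decide (v ε i < 0), fun i => |v ε i|,
    θ - ∑ i, if v ε i < 0 then v ε i else 0, realizes_iff.2 fun x => ?_,
    fun i => abs_pos.2 (hεv i)⟩
  rw [complement, hε, sub_lt_iff_lt_add]
  suffices H : dot (v ε) (fun i => xor (decide (v ε i < 0)) (x i)) =
      dot (fun i => |v ε i|) x + ∑ i, if v ε i < 0 then v ε i else 0 by rw [H]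
  rw [dot, dot, ← Finset.sum_add_distrib]
  refine Finset.sum_congr rfl fun i _ => ?_
  by_cases hi : v ε i < 0
  · cases x i <;> simp [hi, abs_of_neg hi]
  · cases x i <;> simp [hi, abs_of_nonneg (not_lt.1 hi)]

/-! ### Permutations of the arguments -/

lemma permute_permute (σ τ : Equiv.Perm (Fin n)) (f : BoolFn n) :
    permute σ (permute τ f) = permute (σ * τ) f := rfl

lemma permute_one (f : BoolFn n) : permute 1 f = f := rfl

lemma dot_permute (σ : Equiv.Perm (Fin n)) (w : Fin n → ℚ) (x : Fin n → Bool) :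
    dot (w ∘ ⇑σ⁻¹) x = dot w (x ∘ σ) := by
  rw [dot, dot, ← Equiv.sum_comp σ]
  simp

protected lemma Realizes.permute {w : Fin n → ℚ} {θ : ℚ} {f : BoolFn n} (h : Realizes w θ f)
    (σ : Equiv.Perm (Fin n)) : Realizes (w ∘ ⇑σ⁻¹) θ (permute σ f) := by
  rw [realizes_iff] at h ⊢
  intro x
  rw [dot_permute]
  exact h _

protected lemma IsPositive.permute {f : BoolFn n} (hf : IsPositive f) (σ : Equiv.Perm (Fin n)) :
    IsPositive (permute σ f) := by
  obtain ⟨w, θ, h, hw⟩ := hf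
  exact ⟨_, θ, h.permute σ, fun i => hw _⟩

protected lemma IsSmall.permute {f : BoolFn n} (hf : IsSmall f) (σ : Equiv.Perm (Fin n)) :
    IsSmall (permute σ f) := by
  obtain ⟨w, θ, h, hw⟩ := hf
  exact ⟨_, θ, h.permute σ, fun i => hw _⟩

protected lemma IsAmple.permute {f : BoolFn n} (hf : IsAmple f) (σ : Equiv.Perm (Fin n)) :
    IsAmple (permute σ f) := by
  obtain ⟨w, θ, h, hw⟩ := hf
  refine ⟨_, θ, h.permute σ, ?_⟩
  rw [← Equiv.sum_comp σ⁻¹ w] at hw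
  exact hw

protected lemma IsSelfDual.permute {f : BoolFn n} (hf : IsSelfDual f) (σ : Equiv.Perm (Fin n)) :
    IsSelfDual (permute σ f) := by
  funext x
  exact congrFun hf (x ∘ σ)

/-! ### Reductions and self-dual lifts -/

lemma IsSelfDual.apply_not {f : BoolFn n} (hf : IsSelfDual f) (x : Fin n → Bool) :
    f (fun i => !x i) = !f x := by
  have := congrFun hf x
  simp only [dual] at this
  rw [← this, Bool.not_not]

lemma insertNth_not (i : Fin (n + 1)) (s : Bool) (x : Fin n → Bool) :
    (fun k => !(i.insertNth s x : Fin (n + 1) → Bool) k) =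
      (i.insertNth (!s) fun j => !x j : Fin (n + 1) → Bool) := by
  funext k
  refine Fin.succAboveCases i ?_ (fun j => ?_) k <;> simp

lemma IsSelfDual.reduction_not {f : BoolFn (n + 1)} (hf : IsSelfDual f) (i : Fin (n + 1))
    (s : Bool) : reduction f i (!s) = dual (reduction f i s) := by
  funext x
  have := hf.apply_not (i.insertNth (!s) x)
  rw [insertNth_not, Bool.not_not] at this
  simp [reduction, dual, this]

/-- A self-dual function is determined by any one of its reductions. -/
lemma IsSelfDual.eq_of_reduction_eq {f g : BoolFn (n + 1)} (hf : IsSelfDual f) (hg : IsSelfDual g)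
    {i : Fin (n + 1)} {s : Bool} (h : reduction f i s = reduction g i s) : f = g := by
  have h' : ∀ t, reduction f i t = reduction g i t := fun t => by
    rcases Bool.eq_or_eq_not t s with rfl | rfl
    · exact h
    · rw [hf.reduction_not, hg.reduction_not, h]
  funext x
  have := congrFun (h' (x i)) (i.removeNth x)
  simpa [reduction] using this

protected lemma Realizes.reduction {w : Fin (n + 1) → ℚ} {θ : ℚ} {f : BoolFn (n + 1)}
    (h : Realizes w θ f) (i : Fin (n + 1)) (s : Bool) :
    Realizes (fun j => w (i.succAbove j)) (θ - w i * (if s then 1 else 0)) (reduction f i s) := by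
  rw [realizes_iff] at h ⊢
  intro x
  rw [LTF.reduction, h, dot_insertNth, sub_lt_iff_lt_add']

protected lemma IsLTF.reduction {f : BoolFn (n + 1)} (hf : IsLTF f) (i : Fin (n + 1)) (s : Bool) :
    IsLTF (reduction f i s) := by
  obtain ⟨w, θ, h⟩ := hf
  exact ⟨_, _, h.reduction i s⟩

protected lemma IsPositive.reduction {f : BoolFn (n + 1)} (hf : IsPositive f) (i : Fin (n + 1))
    (s : Bool) : IsPositive (reduction f i s) := by
  obtain ⟨w, θ, h, hw⟩ := hf
  exact ⟨_, _, h.reduction i s, fun j => hw _⟩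

lemma antiSelfDualize_eq_reduction (F : BoolFn (n + 1)) :
    antiSelfDualize F = reduction F 0 false := by
  funext x
  simp [antiSelfDualize, reduction]

/-- The self-dual function of `x₀, …, xₙ` whose reduction at `x₀ = s` is `h`. -/
def selfDualLift (s : Bool) (h : BoolFn n) : BoolFn (n + 1) :=
  fun x => if x 0 = s then h (Fin.tail x) else dual h (Fin.tail x)

lemma selfDualize_eq_selfDualLift (h : BoolFn n) : selfDualize h = selfDualLift false h := by
  funext x
  cases hx : x 0 <;> simp [selfDualize, selfDualLift, hx]

lemma selfDualLift_true (h : BoolFn n) :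
    selfDualLift true h = complement (fun i => decide (i = 0)) (selfDualLift false h) := by
  funext x
  have : Fin.tail (fun i => xor (decide (i = 0)) (x i)) = Fin.tail x := by
    funext j
    simp [Fin.tail]
  cases hx : x 0 <;> simp [selfDualLift, complement, hx, this]

lemma isSelfDual_selfDualLift (s : Bool) (h : BoolFn n) : IsSelfDual (selfDualLift s h) := by
  funext x
  have ht : Fin.tail (fun i => !x i) = fun j => !Fin.tail x j := rfl
  simp only [dual, selfDualLift, ht]
  rcases Bool.eq_or_eq_not (x 0) s with hx | hx <;> simp [hx]

lemma reduction_selfDualLift (s : Bool) (h : BoolFn n) :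
    reduction (selfDualLift s h) 0 s = h := by
  funext x
  simp [reduction, selfDualLift]

lemma IsSelfDual.selfDualize_antiSelfDualize {F : BoolFn (n + 1)} (hF : IsSelfDual F) :
    selfDualize (antiSelfDualize F) = F := by
  rw [selfDualize_eq_selfDualLift]
  refine (isSelfDual_selfDualLift _ _).eq_of_reduction_eq hF (i := 0) (s := false) ?_
  rw [reduction_selfDualLift, antiSelfDualize_eq_reduction]

lemma antiSelfDualize_selfDualize (f : BoolFn n) : antiSelfDualize (selfDualize f) = f := by
  rw [selfDualize_eq_selfDualLift, antiSelfDualize_eq_reduction, reduction_selfDualLift]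

/-- A realization without boolean vectors on the separating hyperplane extends to the self-dual
lifts. The weight of the new variable is the distance of `2 θ` from the sum of the weights, with a
sign which depends on the lift. -/
protected lemma Realizes.selfDualLift {w : Fin n → ℚ} {θ : ℚ} {h : BoolFn n} (hr : Realizes w θ h)
    (hne : ∀ x, dot w x ≠ θ) :
    Realizes (Fin.cons (2 * θ - ∑ i, w i) w : Fin (n + 1) → ℚ) θ (selfDualLift false h) ∧
    Realizes (Fin.cons (∑ i, w i - 2 * θ) w : Fin (n + 1) → ℚ) (∑ i, w i - θ)
      (selfDualLift true h) := by
  have hr' := realizes_iff.1 hr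
  have hd : ∀ x, dual h x = true ↔ ∑ i, w i - θ < dot w x := fun x => by
    have h1 := hr' (fun i => !x i)
    have h2 := hne (fun i => !x i)
    rw [dot_not] at h1 h2
    rw [dual, Bool.not_eq_true', ← Bool.not_eq_true, h1, not_lt, sub_lt_comm]
    exact ⟨fun h3 => lt_of_le_of_ne h3 h2, le_of_lt⟩
  have hdot : ∀ (c : ℚ) (x : Fin (n + 1) → Bool), dot (Fin.cons c w : Fin (n + 1) → ℚ) x =
      c * (if x 0 then 1 else 0) + dot w (Fin.tail x) := fun c x => by
    simp only [dot, Fin.sum_univ_succ, Fin.cons_zero, Fin.cons_succ, Fin.tail]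
    rfl
  constructor <;> rw [realizes_iff] <;> intro x <;> rw [hdot, LTF.selfDualLift]
  · cases x 0
    · simpa using hr' _
    · simp only [Bool.true_eq_false, if_false, if_true, hd]
      constructor <;> intro <;> linarith
  · cases x 0
    · simpa using hd _
    · simp only [if_true, hr']
      constructor <;> intro <;> linarith

lemma IsLTF.selfDualLift_false {h : BoolFn n} (hh : IsLTF h) : IsLTF (selfDualLift false h) := by
  obtain ⟨w, θ, hr⟩ := hh
  obtain ⟨θ, -, -, hr, hne⟩ := hr.exists_strict (lt_add_one θ)
  exact ⟨_, _, (hr.selfDualLift hne).1⟩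

/-! ### Smallness -/

lemma isSmall_iff {f : BoolFn n} (hf : IsPositive f) :
    IsSmall f ↔ ∀ j, f (fun k => decide (k = j)) = false := by
  constructor
  · rintro ⟨w, θ, h, hw⟩ j
    rw [← Bool.not_eq_true, realizes_iff.1 h, dot_single]
    exact (hw j).not_gt
  · intro h0
    obtain ⟨w, θ, h, -⟩ := hf
    refine ⟨w, θ, h, fun j => ?_⟩
    have := h0 j
    rw [← Bool.not_eq_true, realizes_iff.1 h, dot_single] at this
    exact not_lt.1 this

lemma isSmallTest_iff {f : BoolFn (n + 1)} (hf : IsPositive f) (i : Fin (n + 1)) (s : Bool) :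
    isSmallTest f i s = true ↔ IsSmall (reduction f i s) := by
  rw [isSmall_iff (hf.reduction i s), isSmallTest, decide_eq_true_iff]

/-! ### Ampleness -/

/-- Negative weights in a realization of a monotone function can be replaced by zero. -/
lemma Realizes.max_zero {w : Fin n → ℚ} {θ : ℚ} {f : BoolFn n} (h : Realizes w θ f)
    (hf : Monotone f) : Realizes (fun i => max (w i) 0) θ f := by
  rw [realizes_iff] at h ⊢
  intro x
  -- The vector obtained from `x` by clearing the arguments with negative weight.
  let y : Fin n → Bool := fun i => x i && decide (0 ≤ w i)
  have hy : dot w y = dot (fun i => max (w i) 0) x := by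
    refine Finset.sum_congr rfl fun i _ => ?_
    by_cases hi : 0 ≤ w i
    · simp [y, hi]
    · simp [y, hi, (not_le.1 hi).le]
  have hyx : y ≤ x := fun i => by
    simp only [y]
    cases x i <;> simp
  have hxy : dot w x ≤ dot w y := by
    rw [hy]
    refine Finset.sum_le_sum fun i _ => mul_le_mul_of_nonneg_right (le_max_left _ _) ?_
    split_ifs <;> norm_num
  rw [← hy, ← h]
  refine ⟨fun hx => (h y).2 (((h x).1 hx).trans_le hxy), ?_⟩
  exact Bool.le_iff_imp.1 (hf hyx)

/-- A positive ample function has a realization which shows both properties at once. -/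
lemma IsAmple.exists_realizes {f : BoolFn n} (ha : IsAmple f) (hf : IsPositive f) :
    ∃ w θ, Realizes w θ f ∧ (∀ i, 0 < w i) ∧ 2 * θ < ∑ i, w i := by
  obtain ⟨v, η, hv, hlt⟩ := ha
  have hv' := realizes_iff.1 (hv.max_zero hf.monotone)
  obtain ⟨w, θ, hw, hpos⟩ := hf
  rw [realizes_iff] at hw
  have hlt' : 2 * η < ∑ i, max (v i) 0 :=
    hlt.trans_le (Finset.sum_le_sum fun i _ => le_max_left _ _)
  -- A small multiple of the positive realization is added to the nonnegative ample one.
  have hcont : Continuous fun ε : ℚ => ∑ i, (max (v i) 0 + ε * w i) - 2 * (η + ε * θ) := by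
    fun_prop
  have hev : ∀ᶠ ε in 𝓝[>] (0 : ℚ),
      0 < ∑ i, (max (v i) 0 + ε * w i) - 2 * (η + ε * θ) := by
    refine nhdsWithin_le_nhds ((hcont.tendsto 0).eventually (eventually_gt_nhds ?_))
    simpa using hlt'
  obtain ⟨ε, hε, hε0⟩ := (hev.and self_mem_nhdsWithin).exists
  have hε0 : 0 < ε := hε0
  refine ⟨(fun i => max (v i) 0) + ε • w, η + ε * θ, realizes_iff.2 fun x => ?_, fun i => ?_, ?_⟩
  · rw [dot_add, dot_smul]
    have h1 := hv' x
    have h2 := hw x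
    by_cases hx : f x = true
    · exact ⟨fun _ => add_lt_add (h1.1 hx) (mul_lt_mul_of_pos_left (h2.1 hx) hε0), fun _ => hx⟩
    · refine ⟨fun h' => absurd h' hx, fun h' => absurd h' (not_lt.2 (add_le_add ?_ ?_))⟩
      · exact not_lt.1 (mt h1.2 hx)
      · exact mul_le_mul_of_nonneg_left (not_lt.1 (mt h2.2 hx)) hε0.le
  · exact add_pos_of_nonneg_of_pos (le_max_right _ _) (mul_pos hε0 (hpos i))
  · exact sub_pos.1 hε

lemma IsAmple.isPositive_selfDualLift {h : BoolFn n} (ha : IsAmple h) (hh : IsPositive h) :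
    IsPositive (selfDualLift true h) := by
  obtain ⟨w, θ, hr, hw, hlt⟩ := ha.exists_realizes hh
  obtain ⟨θ', -, h2, hr, hne⟩ := hr.exists_strict (show θ < (∑ i, w i) / 2 by linarith)
  refine ⟨_, _, (hr.selfDualLift hne).2, fun i => ?_⟩
  refine Fin.cases ?_ (fun j => ?_) i
  · simp only [Fin.cons_zero]
    linarith
  · simpa using hw j

lemma IsPositive.isPositive_selfDualLift {h : BoolFn n} (hh : IsPositive h) (ha : ¬ IsAmple h) :
    IsPositive (selfDualLift false h) := by
  obtain ⟨w, θ, hr, hw⟩ := hh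
  have hle : ∑ i, w i ≤ 2 * θ := not_lt.1 fun hlt => ha ⟨w, θ, hr, hlt⟩
  obtain ⟨θ', h1, -, hr, hne⟩ := hr.exists_strict (lt_add_one θ)
  refine ⟨_, _, (hr.selfDualLift hne).1, fun i => ?_⟩
  refine Fin.cases ?_ (fun j => ?_) i
  · simp only [Fin.cons_zero]
    linarith
  · simpa using hw j

/-- The threshold of a self-dual function can be taken to be half of the sum of the weights. -/
lemma Realizes.half_of_isSelfDual {w : Fin n → ℚ} {θ : ℚ} {f : BoolFn n} (h : Realizes w θ f)
    (hf : IsSelfDual f) : Realizes w ((∑ i, w i) / 2) f := by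
  rw [realizes_iff] at h ⊢
  intro x
  have h1 := h x
  have h2 := h (fun i => !x i)
  rw [hf.apply_not, dot_not] at h2
  cases hx : f x
  · simp only [hx, Bool.not_false, true_iff, Bool.false_eq_true, false_iff] at h1 h2 ⊢
    linarith
  · simp only [hx, Bool.not_true, true_iff, Bool.false_eq_true, false_iff] at h1 h2 ⊢
    linarith

lemma IsPositive.isAmple_reduction_true {f : BoolFn (n + 1)} (hf : IsPositive f)
    (hsd : IsSelfDual f) (i : Fin (n + 1)) : IsAmple (reduction f i true) := by
  obtain ⟨w, θ, h, hw⟩ := hf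
  refine ⟨_, _, (h.half_of_isSelfDual hsd).reduction i true, ?_⟩
  have := hw i
  rw [Fin.sum_univ_succAbove _ i]
  simp only [if_true]
  linarith

lemma IsPositive.reduction_false_le {f : BoolFn (n + 1)} (hf : IsPositive f) (i : Fin (n + 1)) :
    reduction f i false ≤ reduction f i true := fun x => by
  refine hf.monotone fun k => ?_
  refine Fin.succAboveCases i ?_ (fun j => ?_) k <;> simp

/-- If `f_{x_i = 0}` is ample, then its lift at `x₀ = 1` is monotone, so the dual function
`f_{x_i = 1}` lies below `f_{x_i = 0}`. As `f` is monotone too, it does not depend on `x_i`. -/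
lemma IsPositive.isAmple_reduction_false_iff {f : BoolFn (n + 1)} (hf : IsPositive f)
    (hsd : IsSelfDual f) (i : Fin (n + 1)) :
    IsAmple (reduction f i false) ↔ reduction f i false = reduction f i true := by
  refine ⟨fun ha => le_antisymm (hf.reduction_false_le i) ?_,
    fun h => h ▸ hf.isAmple_reduction_true hsd i⟩
  have h1 := (ha.isPositive_selfDualLift (hf.reduction i false)).reduction_false_le 0
  have h2 := (isSelfDual_selfDualLift true (reduction f i false)).reduction_not 0 true
  rw [reduction_selfDualLift] at h1 h2
  rw [Bool.not_true] at h2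
  rw [h2, ← hsd.reduction_not, Bool.not_false] at h1
  exact h1

/-! ### Chow parameters as Fourier coefficients -/

/-- The sign `1` or `-1` of a truth value. -/
def sgn (b : Bool) : ℚ := if b then 1 else -1

lemma sgn_not (b : Bool) : sgn (!b) = -sgn b := by cases b <;> simp [sgn]

lemma sgn_xor (a b : Bool) : sgn (xor a b) = -(sgn a * sgn b) := by
  cases a <;> cases b <;> simp [sgn]

lemma abs_sgn (b : Bool) : |sgn b| = 1 := by cases b <;> simp [sgn]

lemma sgn_mono {a b : Bool} (h : a ≤ b) : sgn a ≤ sgn b := by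
  revert h
  cases a <;> cases b <;> simp [sgn]

lemma sgn_mul_sgn (a b : Bool) : sgn a * sgn b = 2 * (if a = b then 1 else 0) - 1 := by
  cases a <;> cases b <;> norm_num [sgn]

/-- The average value of `f` in the sign convention. -/
def bias (f : BoolFn n) : ℚ := (∑ x, sgn (f x)) / 2 ^ n

/-- The degree-one Fourier coefficient of `f` at the `i`-th argument. -/
def coef (f : BoolFn n) (i : Fin n) : ℚ := (∑ x, sgn (f x) * sgn (x i)) / 2 ^ n

lemma sum_insertNth {M : Type*} [AddCommMonoid M] (i : Fin (n + 1))
    (g : (Fin (n + 1) → Bool) → M) :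
    ∑ x, g x = ∑ y, g (i.insertNth true y) + ∑ y, g (i.insertNth false y) := by
  rw [← (Fin.insertNthEquiv (fun _ => Bool) i).sum_comp, Fintype.sum_prod_type, Fintype.sum_bool]
  rfl

lemma sum_not {M : Type*} [AddCommMonoid M] (g : (Fin n → Bool) → M) :
    ∑ x : Fin n → Bool, g (fun i => !x i) = ∑ x, g x :=
  Fintype.sum_bijective (fun (x : Fin n → Bool) i => !x i)
    (Function.Involutive.bijective fun x => by simp) _ _ fun _ => rfl

lemma chow_eq_sum (f : BoolFn n) (i : Fin n) :
    chow f i = ∑ x, if f x = x i then 1 else 0 := by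
  rw [chow, Finset.sum_filter, Finset.sum_filter, ← Finset.sum_add_distrib]
  refine Finset.sum_congr rfl fun x _ => ?_
  cases f x <;> cases x i <;> rfl

/-- The Chow parameters are the degree-one Fourier coefficients in an affine disguise. -/
lemma coef_eq (f : BoolFn n) (i : Fin n) : coef f i = 2 * chow f i / 2 ^ n - 1 := by
  have h : (∑ x : Fin n → Bool, (1 : ℚ)) = 2 ^ n := by simp
  rw [coef, chow_eq_sum]
  simp only [sgn_mul_sgn, Finset.sum_sub_distrib, ← Finset.mul_sum, h]
  push_cast
  rw [sub_div, div_self (by positivity)]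

lemma coef_eq_coef_iff {f g : BoolFn n} {i j : Fin n} :
    coef f i = coef g j ↔ chow f i = chow g j := by
  rw [coef_eq, coef_eq, sub_left_inj, div_left_inj' (by positivity),
    mul_right_inj' (by norm_num), Nat.cast_inj]

lemma bias_eq_zero {f : BoolFn n} (hf : IsSelfDual f) : bias f = 0 := by
  have h : ∑ x, sgn (f x) = -∑ x, sgn (f x) := by
    conv_lhs => rw [← sum_not]
    simp only [hf.apply_not, sgn_not, Finset.sum_neg_distrib]
  rw [bias, show ∑ x, sgn (f x) = 0 by linarith, zero_div]

lemma coef_nonneg {f : BoolFn (n + 1)} (hf : IsPositive f) (i : Fin (n + 1)) : 0 ≤ coef f i := by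
  refine div_nonneg ?_ (by positivity)
  rw [sum_insertNth i, ← Finset.sum_add_distrib]
  refine Finset.sum_nonneg fun y _ => ?_
  have := sgn_mono (hf.reduction_false_le i y)
  simp only [reduction] at this
  simp only [Fin.insertNth_apply_same, sgn]
  simp only [sgn] at this
  norm_num
  linarith

/-- Chow's theorem: a linear threshold function is determined among all boolean functions by its
average and its degree-one Fourier coefficients. -/
theorem IsLTF.eq_of_coef_eq {f g : BoolFn n} (hf : IsLTF f) (h0 : bias f = bias g)
    (h : ∀ i, coef f i = coef g i) : f = g := by
  obtain ⟨w, θ, hr⟩ := hf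
  obtain ⟨θ, -, -, hr, hne⟩ := hr.exists_strict (lt_add_one θ)
  rw [realizes_iff] at hr
  have h2 : (2 : ℚ) ^ n ≠ 0 := by positivity
  have h0' : ∑ x, (sgn (f x) - sgn (g x)) = 0 := by
    rw [Finset.sum_sub_distrib, sub_eq_zero]
    exact (div_left_inj' h2).1 h0
  have h' : ∀ i, ∑ x : Fin n → Bool, (sgn (f x) - sgn (g x)) * sgn (x i) = 0 := fun i => by
    simp only [sub_mul]
    rw [Finset.sum_sub_distrib, sub_eq_zero]
    exact (div_left_inj' h2).1 (h i)
  have hdot : ∀ x, dot w x - θ = ∑ i, w i / 2 * sgn (x i) + (∑ i, w i / 2 - θ) := fun x => by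
    rw [← add_sub_assoc, ← Finset.sum_add_distrib, dot]
    congr 1
    refine Finset.sum_congr rfl fun i _ => ?_
    simp only [sgn]
    split_ifs <;> ring
  -- The affine form `w · x - θ` has the sign of `f`, so all terms of the next sum are nonnegative.
  have hsum : ∑ x, (sgn (f x) - sgn (g x)) * (dot w x - θ) = 0 := by
    simp only [hdot, mul_add, Finset.sum_add_distrib, ← Finset.sum_mul, h0', zero_mul, add_zero,
      Finset.mul_sum]
    rw [Finset.sum_comm]
    refine Finset.sum_eq_zero fun i _ => ?_
    have := congrArg (fun t => w i / 2 * t) (h' i)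
    simp only [Finset.mul_sum, mul_zero] at this
    rw [← this]
    exact Finset.sum_congr rfl fun x _ => by ring
  have hnn : ∀ x, 0 ≤ (sgn (f x) - sgn (g x)) * (dot w x - θ) := fun x => by
    have h1 := hr x
    cases hfx : f x
    · have : dot w x ≤ θ := not_lt.1 (mt h1.2 (by simp [hfx]))
      refine mul_nonneg_of_nonpos_of_nonpos ?_ (by linarith)
      cases g x <;> norm_num [sgn]
    · have : θ < dot w x := h1.1 hfx
      refine mul_nonneg ?_ (by linarith)
      cases g x <;> norm_num [sgn]
  funext x
  have hx := (Finset.sum_eq_zero_iff_of_nonneg fun x _ => hnn x).1 hsum x (Finset.mem_univ x)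
  rcases mul_eq_zero.1 hx with hx | hx
  · revert hx
    cases f x <;> cases g x <;> norm_num [sgn]
  · exact absurd (sub_eq_zero.1 hx) (hne x)

lemma coef_permute (σ : Equiv.Perm (Fin n)) (f : BoolFn n) (i : Fin n) :
    coef (permute σ f) i = coef f (σ⁻¹ i) := by
  rw [coef, coef]
  congr 1
  refine Fintype.sum_equiv (Equiv.arrowCongr σ.symm (Equiv.refl Bool)) _ _ fun x => ?_
  simp [permute, Equiv.arrowCongr, Function.comp_def]

lemma chow_permute (σ : Equiv.Perm (Fin n)) (f : BoolFn n) (i : Fin n) :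
    chow (permute σ f) i = chow f (σ⁻¹ i) :=
  coef_eq_coef_iff.1 (coef_permute σ f i)

/-- By Chow's theorem, a permutation takes one self-dual function to another, the first of which is
a threshold function, exactly if it matches their Chow parameters. -/
lemma permute_eq_iff {f g : BoolFn n} (hf : IsLTF f) (hsf : IsSelfDual f) (hsg : IsSelfDual g)
    (σ : Equiv.Perm (Fin n)) : permute σ f = g ↔ ∀ i, chow g (σ i) = chow f i := by
  constructor
  · rintro rfl i
    simp [chow_permute]
  · intro h
    obtain ⟨w, θ, hr⟩ := hf
    refine IsLTF.eq_of_coef_eq ⟨_, _, hr.permute σ⟩ ?_ fun i => ?_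
    · rw [bias_eq_zero (hsf.permute σ), bias_eq_zero hsg]
    · rw [coef_permute, coef_eq_coef_iff, ← h]
      simp

/-! ### An invariant of SD classes -/

/-- The multiset of the nonzero absolute values among the average and the degree-one Fourier
coefficients. -/
def chowSpectrum (f : BoolFn n) : Multiset ℚ :=
  (|bias f| ::ₘ Finset.univ.val.map fun i => |coef f i|).filter (· ≠ 0)

lemma bias_permute (σ : Equiv.Perm (Fin n)) (f : BoolFn n) : bias (permute σ f) = bias f := by
  rw [bias, bias]
  congr 1
  exact Fintype.sum_equiv (Equiv.arrowCongr σ.symm (Equiv.refl Bool)) _ _ fun x => rfl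

lemma chowSpectrum_permute (σ : Equiv.Perm (Fin n)) (f : BoolFn n) :
    chowSpectrum (permute σ f) = chowSpectrum f := by
  have : (Finset.univ.val.map fun i => |coef f (σ⁻¹ i)|) =
      Finset.univ.val.map fun i => |coef f i| := by
    conv_rhs => rw [← Multiset.map_univ_val_equiv σ⁻¹, Multiset.map_map]
    rfl
  simp only [chowSpectrum, bias_permute, coef_permute, this]

lemma sum_xor {M : Type*} [AddCommMonoid M] (u : Fin n → Bool) (g : (Fin n → Bool) → M) :
    ∑ x : Fin n → Bool, g (fun i => xor (u i) (x i)) = ∑ x, g x :=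
  Fintype.sum_bijective (fun (x : Fin n → Bool) i => xor (u i) (x i))
    (Function.Involutive.bijective fun x => by simp) _ _ fun _ => rfl

lemma chowSpectrum_complement (u : Fin n → Bool) (f : BoolFn n) :
    chowSpectrum (complement u f) = chowSpectrum f := by
  have hb : bias (complement u f) = bias f := by
    rw [bias, bias, ← sum_xor u fun x => sgn (f x)]
    rfl
  have hc : ∀ i, |coef (complement u f) i| = |coef f i| := fun i => by
    have : coef (complement u f) i = -sgn (u i) * coef f i := by
      rw [coef, coef, ← sum_xor u fun x => sgn (f x) * sgn (x i), ← mul_div_assoc,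
        Finset.mul_sum]
      congr 1
      refine Finset.sum_congr rfl fun x _ => ?_
      simp only [complement, sgn_xor]
      have : sgn (u i) * sgn (u i) = 1 := by cases u i <;> simp [sgn]
      linear_combination (-(sgn (f fun i => xor (u i) (x i))) * sgn (x i)) * this
    rw [this, abs_mul, abs_neg, abs_sgn, one_mul]
  simp only [chowSpectrum, hb, hc]

lemma chowSpectrum_not (f : BoolFn n) : chowSpectrum (fun x => !f x) = chowSpectrum f := by
  have hb : bias (fun x => !f x) = -bias f := by
    simp only [bias, sgn_not, Finset.sum_neg_distrib, neg_div]
  have hc : ∀ i, coef (fun x => !f x) i = -coef f i := fun i => by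
    simp only [coef, sgn_not, neg_mul, Finset.sum_neg_distrib, neg_div]
  simp only [chowSpectrum, hb, hc, abs_neg]

/-- Self-dualization turns the average into a degree-one coefficient, up to sign. -/
lemma chowSpectrum_selfDualize (f : BoolFn n) : chowSpectrum (selfDualize f) = chowSpectrum f := by
  have hb : bias (selfDualize f) = 0 := by
    rw [selfDualize_eq_selfDualLift]
    exact bias_eq_zero (isSelfDual_selfDualLift _ _)
  have h2 : (2 : ℚ) ^ n ≠ 0 := by positivity
  have h0 : coef (selfDualize f) 0 = -bias f := by
    rw [coef, bias, sum_insertNth 0]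
    simp only [selfDualize, dual, Fin.insertNth_zero', Fin.cons_zero, Fin.tail_cons, if_true,
      Bool.false_eq_true, if_false, sgn_not]
    rw [show sgn true = 1 from rfl, show sgn false = -1 from rfl, ← Finset.sum_mul,
      ← Finset.sum_mul, Finset.sum_neg_distrib, sum_not fun x => sgn (f x)]
    field_simp
    ring
  have hs : ∀ j : Fin n, coef (selfDualize f) j.succ = coef f j := fun j => by
    rw [coef, coef, sum_insertNth 0]
    simp only [selfDualize, dual, Fin.insertNth_zero', Fin.cons_zero, Fin.cons_succ,
      Fin.tail_cons, if_true, Bool.false_eq_true, if_false, sgn_not]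
    have : ∑ x : Fin n → Bool, -sgn (f fun i => !x i) * sgn (x j) =
        ∑ x, sgn (f x) * sgn (x j) := by
      rw [← sum_not fun x => sgn (f x) * sgn (x j)]
      simp only [sgn_not, neg_mul, mul_neg]
    rw [this]
    field_simp
    ring
  have huniv : (Finset.univ.val.map fun i => |coef (selfDualize f) i|) =
      |bias f| ::ₘ Finset.univ.val.map fun i => |coef f i| := by
    rw [Fin.univ_val_map, List.ofFn_succ, Fin.univ_val_map, Multiset.cons_coe]
    simp only [h0, hs, abs_neg]
  rw [chowSpectrum, chowSpectrum, hb, huniv,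
    Multiset.filter_cons_of_neg (p := fun q : ℚ => q ≠ 0) _ (by simp)]

lemma SDStep.chowSpectrum_eq {p q : Σ n, BoolFn n} (h : SDStep p q) :
    chowSpectrum p.2 = chowSpectrum q.2 := by
  cases h with
  | perm σ f => exact (chowSpectrum_permute σ f).symm
  | compl u f => exact (chowSpectrum_complement u f).symm
  | neg f => exact (chowSpectrum_not f).symm
  | sd f => exact (chowSpectrum_selfDualize f).symm
  | antisd F hF =>
    conv_lhs => rw [← hF.selfDualize_antiSelfDualize]
    exact chowSpectrum_selfDualize _

lemma SameSDClass.chowSpectrum_eq {m : ℕ} {f : BoolFn m} {h : BoolFn n} (hfh : SameSDClass f h) :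
    chowSpectrum f = chowSpectrum h := by
  have : ∀ {p q : Σ n, BoolFn n}, Relation.ReflTransGen SDStep p q →
      chowSpectrum p.2 = chowSpectrum q.2 := fun hpq => by
    induction hpq with
    | refl => rfl
    | tail _ hs ih => exact ih.trans hs.chowSpectrum_eq
  exact this (p := ⟨m, f⟩) (q := ⟨n, h⟩) hfh

lemma SDStep.symm {p q : Σ n, BoolFn n} (h : SDStep p q) : SDStep q p := by
  cases h with
  | perm σ f =>
    have := SDStep.perm σ⁻¹ (permute σ f)
    rwa [permute_permute, inv_mul_cancel, permute_one] at this
  | compl u f =>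
    have := SDStep.compl u (complement u f)
    rwa [show complement u (complement u f) = f by funext x; simp [complement]] at this
  | neg f =>
    have := SDStep.neg fun x => !f x
    simpa only [Bool.not_not] using this
  | sd f =>
    have := SDStep.antisd (selfDualize f)
      (selfDualize_eq_selfDualLift f ▸ isSelfDual_selfDualLift _ _)
    rwa [antiSelfDualize_selfDualize] at this
  | antisd F hF =>
    have := SDStep.sd (antiSelfDualize F)
    rwa [hF.selfDualize_antiSelfDualize] at this

lemma SameSDClass.symm {m : ℕ} {f : BoolFn m} {h : BoolFn n} (hfh : SameSDClass f h) :
    SameSDClass h f :=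
  haveI : Std.Symm SDStep := ⟨fun _ _ => SDStep.symm⟩
  Std.Symm.symm (r := Relation.ReflTransGen SDStep) _ _ hfh

lemma SameSDClass.trans {k m : ℕ} {f : BoolFn m} {g : BoolFn k} {h : BoolFn n}
    (hfg : SameSDClass f g) (hgh : SameSDClass g h) : SameSDClass f h :=
  Relation.ReflTransGen.trans hfg hgh

lemma sameSDClass_permute (σ : Equiv.Perm (Fin n)) (f : BoolFn n) : SameSDClass f (permute σ f) :=
  .single (.perm σ f)

lemma sameSDClass_complement (u : Fin n → Bool) (f : BoolFn n) : SameSDClass f (complement u f) :=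
  .single (.compl u f)

lemma sameSDClass_selfDualLift (s : Bool) (h : BoolFn n) : SameSDClass h (selfDualLift s h) := by
  have : SameSDClass h (selfDualLift false h) := selfDualize_eq_selfDualLift h ▸ .single (.sd h)
  cases s
  · exact this
  · rw [selfDualLift_true]
    exact this.trans (sameSDClass_complement _ _)

lemma eq_of_filter_ne_zero_eq {s t : Multiset ℚ} (hc : s.card = t.card)
    (h : s.filter (· ≠ 0) = t.filter (· ≠ 0)) : s = t := by
  have hs := Multiset.filter_add_not (· ≠ (0 : ℚ)) s
  have ht := Multiset.filter_add_not (· ≠ (0 : ℚ)) t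
  simp only [not_not, Multiset.filter_eq'] at hs ht
  have hs' := congrArg Multiset.card hs
  have ht' := congrArg Multiset.card ht
  rw [Multiset.card_add, Multiset.card_replicate] at hs' ht'
  rw [h] at hs hs'
  have hcount : Multiset.count 0 s = Multiset.count 0 t := by omega
  exact hs.symm.trans (hcount ▸ ht)

/-- Positive self-dual threshold functions with the same number of variables in one SD class
differ by a permutation of the arguments only. -/
theorem SameSDClass.exists_permute_eq {f g : BoolFn (n + 1)} (h : SameSDClass f g)
    (hf : IsPositive f) (hg : IsPositive g) (hsf : IsSelfDual f) (hsg : IsSelfDual g) :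
    ∃ σ, permute σ f = g := by
  have hspec := h.chowSpectrum_eq
  simp only [chowSpectrum, bias_eq_zero hsf, bias_eq_zero hsg, abs_of_nonneg (coef_nonneg hf _),
    abs_of_nonneg (coef_nonneg hg _)] at hspec
  have hmul := eq_of_filter_ne_zero_eq (by simp) hspec
  rw [Multiset.cons_inj_right] at hmul
  have hcard : ∀ q, Fintype.card {i // coef f i = q} = Fintype.card {i // coef g i = q} :=
    fun q => by
      have := congrArg (Multiset.count q) hmul
      simp only [Multiset.count_map] at this
      simp only [Fintype.card_subtype, Finset.card_def, Finset.filter_val, eq_comm (b := q)]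
      exact this
  refine ⟨Equiv.ofFiberEquiv fun q => Fintype.equivOfCardEq (hcard q), ?_⟩
  rw [permute_eq_iff hf.isLTF hsf hsg]
  exact fun i => coef_eq_coef_iff.1 (Equiv.ofFiberEquiv_map _ i)

/-! ### Chow parameters of self-dual functions -/

lemma chowZero_eq_sum (f : BoolFn n) : chowZero f = ∑ x, if f x = true then 1 else 0 := by
  rw [chowZero, Finset.card_filter]

lemma chowZero_dual_add (f : BoolFn n) : chowZero (dual f) + chowZero f = 2 ^ n := by
  rw [chowZero_eq_sum, chowZero_eq_sum, ← sum_not fun x => if f x = true then 1 else 0,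
    ← Finset.sum_add_distrib]
  have : ∀ x : Fin n → Bool, ((if dual f x = true then 1 else 0) +
      if (f fun i => !x i) = true then 1 else 0) = 1 := fun x => by
    rcases h : f fun i => !x i <;> simp [dual, h]
  simp [this]

lemma IsSelfDual.chowZero_eq {f : BoolFn (n + 1)} (hf : IsSelfDual f) : chowZero f = 2 ^ n := by
  have := chowZero_dual_add f
  rw [hf] at this
  omega

lemma IsSelfDual.chow_eq {f : BoolFn (n + 1)} (hf : IsSelfDual f) (i : Fin (n + 1)) :
    chow f i = 2 * chowZero (reduction f i true) := by
  have h0 : ∀ y, f (i.insertNth false y) = !reduction f i true fun j => !y j := fun y =>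
    congrFun (hf.reduction_not i true) y
  rw [chow_eq_sum, sum_insertNth i, chowZero_eq_sum, two_mul]
  congr 1
  · refine Finset.sum_congr rfl fun y _ => ?_
    rw [Fin.insertNth_apply_same, reduction]
  · rw [← sum_not fun x => if reduction f i true x = true then 1 else 0]
    simp [h0]

lemma IsSelfDual.halfChow_eq {f : BoolFn (n + 1)} (hf : IsSelfDual f) (i : Fin (n + 1)) :
    halfChow f i = chowZero (reduction f i true) := by
  rw [halfChow, hf.chow_eq, Nat.mul_div_cancel_left _ two_pos]

lemma IsSelfDual.chow_eq_two_mul {f : BoolFn (n + 1)} (hf : IsSelfDual f) (i : Fin (n + 1)) :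
    chow f i = 2 * halfChow f i := by
  rw [hf.halfChow_eq, hf.chow_eq]

lemma IsSelfDual.halfChow_eq_iff {f g : BoolFn (n + 1)} (hf : IsSelfDual f) (hg : IsSelfDual g)
    {i j : Fin (n + 1)} : halfChow f i = halfChow g j ↔ chow f i = chow g j := by
  rw [hf.chow_eq_two_mul, hg.chow_eq_two_mul, mul_right_inj' two_ne_zero]

/-- This holds since `a_i` is the number of true vectors of `f_{x_i = 1}`, which is at least that of
`f_{x_i = 0}`, and the two numbers have sum `2 ^ n`. -/
lemma IsPositive.two_pow_le {f : BoolFn (n + 1)} (hf : IsPositive f) (hsd : IsSelfDual f)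
    (i : Fin (n + 1)) : 2 ^ n ≤ 2 * halfChow f i := by
  have h1 := chowZero_dual_add (reduction f i true)
  rw [← hsd.reduction_not, Bool.not_true] at h1
  have h2 : chowZero (reduction f i false) ≤ chowZero (reduction f i true) :=
    Finset.card_le_card (Finset.monotone_filter_right _ fun x _ =>
      Bool.le_iff_imp.1 (hf.reduction_false_le i x))
  rw [hsd.halfChow_eq]
  omega

lemma IsPositive.two_mul_halfChow_eq_iff {f : BoolFn (n + 1)} (hf : IsPositive f)
    (hsd : IsSelfDual f) (i : Fin (n + 1)) :
    2 * halfChow f i = 2 ^ n ↔ reduction f i false = reduction f i true := by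
  have h1 := chowZero_dual_add (reduction f i true)
  rw [← hsd.reduction_not, Bool.not_true] at h1
  rw [hsd.halfChow_eq]
  constructor
  · intro h
    have hsub : (Finset.univ.filter fun x => reduction f i false x = true) ⊆
        Finset.univ.filter fun x => reduction f i true x = true :=
      Finset.monotone_filter_right _ fun x _ => Bool.le_iff_imp.1 (hf.reduction_false_le i x)
    have heq := Finset.eq_of_subset_of_card_le hsub (by
      rw [chowZero, chowZero] at h1
      rw [chowZero] at h
      omega)
    funext x
    have := congrArg (x ∈ ·) heq
    simpa using this
  · intro h
    rw [h] at h1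
    omega

/-! ### Permutations which respect a distinguished argument -/

lemma exists_perm_succAbove (σ : Equiv.Perm (Fin (n + 1))) (i : Fin (n + 1)) :
    ∃ τ : Equiv.Perm (Fin n), ∀ j, σ (i.succAbove j) = (σ i).succAbove (τ j) := by
  have h : ∀ j, ∃ k, (σ i).succAbove k = σ (i.succAbove j) := fun j =>
    Fin.exists_succAbove_eq fun h => Fin.succAbove_ne i j (σ.injective h)
  choose τ hτ using h
  have hinj : Function.Injective τ := fun j k hjk =>
    Fin.succAbove_right_injective (σ.injective (by rw [← hτ, ← hτ, hjk]))
  exact ⟨Equiv.ofBijective τ (Finite.injective_iff_bijective.1 hinj), fun j => (hτ j).symm⟩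

lemma exists_perm_extend (τ : Equiv.Perm (Fin n)) (i k : Fin (n + 1)) :
    ∃ σ : Equiv.Perm (Fin (n + 1)), σ i = k ∧ ∀ j, σ (i.succAbove j) = k.succAbove (τ j) := by
  let σ : Fin (n + 1) → Fin (n + 1) := i.insertNth k fun j => k.succAbove (τ j)
  have hinj : Function.Injective σ := by
    intro a b
    refine Fin.succAboveCases i ?_ (fun j => ?_) a <;>
      refine Fin.succAboveCases i ?_ (fun l => ?_) b
    · simp
    · simp [σ, (Fin.succAbove_ne k _).symm]
    · simp [σ, Fin.succAbove_ne k _]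
    · simp [σ]
  exact ⟨Equiv.ofBijective σ (Finite.injective_iff_bijective.1 hinj), by simp [σ], by simp [σ]⟩

lemma reduction_permute {σ : Equiv.Perm (Fin (n + 1))} {τ : Equiv.Perm (Fin n)}
    {i k : Fin (n + 1)} (hi : σ i = k) (h : ∀ j, σ (i.succAbove j) = k.succAbove (τ j))
    (f : BoolFn (n + 1)) (s : Bool) :
    reduction (permute σ f) k s = permute τ (reduction f i s) := by
  funext x
  rw [reduction, permute, permute, reduction]
  congr 1
  funext l
  refine Fin.succAboveCases i ?_ (fun j => ?_) l
  · simp [hi]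
  · simp [h]

/-! ### The number of functions which arise by permutation -/

/-- A permutation of the arguments of `f_{x_i = s}` fixes this function exactly if it preserves the
Chow parameters of `f`. -/
lemma permute_reduction_eq_iff {f : BoolFn (n + 1)} (hf : IsLTF f) (hsd : IsSelfDual f)
    (i : Fin (n + 1)) (s : Bool) (τ : Equiv.Perm (Fin n)) :
    permute τ (reduction f i s) = reduction f i s ↔
      (fun j => halfChow f (i.succAbove j)) ∘ τ = fun j => halfChow f (i.succAbove j) := by
  obtain ⟨σ, hi, hσ⟩ := exists_perm_extend τ i i
  rw [← reduction_permute hi hσ]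
  have h1 : reduction (permute σ f) i s = reduction f i s ↔ permute σ f = f :=
    ⟨fun h => (hsd.permute σ).eq_of_reduction_eq hsd h, fun h => by rw [h]⟩
  rw [h1, permute_eq_iff hf hsd hsd, Fin.forall_iff_succAbove i]
  simp only [hi, hσ, true_and, funext_iff, Function.comp_apply, hsd.halfChow_eq_iff hsd]

open scoped Nat in
theorem permCount_eq {f : BoolFn (n + 1)} (hf : IsLTF f) (hsd : IsSelfDual f)
    (i : Fin (n + 1)) (s : Bool) :
    permCount (halfChow f) i =
      (Set.range fun σ : Equiv.Perm (Fin n) => permute σ (reduction f i s)).ncard := by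
  let _ : MulAction (Equiv.Perm (Fin n)) (BoolFn n) :=
    { smul := permute, one_smul := permute_one, mul_smul := fun _ _ _ => rfl }
  set g := reduction f i s
  set b : Fin n → ℕ := fun j => halfChow f (i.succAbove j) with hb
  have hstab : Nat.card (MulAction.stabilizer (Equiv.Perm (Fin n)) g) =
      ∏ v ∈ Finset.univ.image b, (Fintype.card {j // b j = v})! := by
    rw [← DomMulAct.stabilizer_card', ← Nat.card_eq_fintype_card]
    exact Nat.card_congr (Equiv.subtypeEquivRight fun τ => permute_reduction_eq_iff hf hsd i s τ)
  have hprod : (∏ v ∈ (Finset.univ.erase i).image (halfChow f),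
      ((Finset.univ.erase i).filter fun j => halfChow f j = v).card !) =
      ∏ v ∈ Finset.univ.image b, (Fintype.card {j // b j = v})! := by
    have huniv : Finset.univ.erase i = Finset.univ.map (Fin.succAboveEmb i) := by
      rw [Fin.univ_succAbove n i, Finset.erase_cons]
    rw [huniv, Finset.map_eq_image, Finset.image_image, ← Finset.map_eq_image]
    refine Finset.prod_congr rfl fun v _ => ?_
    rw [Finset.filter_map, Finset.card_map, Fintype.card_subtype]
    rfl
  have hmul := (MulAction.stabilizer (Equiv.Perm (Fin n)) g).card_mul_index
  rw [MulAction.index_stabilizer, Nat.card_perm, Nat.card_fin, hstab] at hmul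
  rw [permCount, hprod, ← hmul]
  refine Nat.mul_div_cancel_left _ (Finset.prod_pos fun v _ => Nat.factorial_pos _)

/-! ### Enumerations of canonical generators -/

/-- Any way of sorting the Chow parameters yields an enumeration of canonical generators. -/
lemma isGeneratorEnumeration_of_sort {P : (Fin (n + 1) → ℕ) → Prop}
    (hP : ∀ a, P a → Monotone a ∨ Antitone a)
    (hsort : ∀ a : Fin (n + 1) → ℕ, ∃ σ : Equiv.Perm (Fin (n + 1)), P (a ∘ σ))
    (huniq : ∀ (a : Fin (n + 1) → ℕ) (σ : Equiv.Perm (Fin (n + 1))), P a → P (a ∘ σ) → a ∘ σ = a)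
    {G : Finset (BoolFn (n + 1))} (hG : ∀ f, f ∈ G ↔ IsCanonicalGenerator f ∧ P (chow f)) :
    IsGeneratorEnumeration n G where
  canonical f hf := ((hG f).1 hf).1
  meets f hf := by
    obtain ⟨⟨hlin, -, hsd, -⟩, -⟩ := (hG f).1 hf
    refine ⟨antiSelfDualize f, ?_, .single (.antisd f hsd)⟩
    rw [antiSelfDualize_eq_reduction]
    exact hlin.reduction 0 false
  existsUnique h hh := by
    obtain ⟨u, hu⟩ := hh.selfDualLift_false.exists_complement_isPositive
    set F := complement u (selfDualLift false h) with hF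
    have hFsd : IsSelfDual F := by
      funext x
      have := (isSelfDual_selfDualLift false h).apply_not fun i => xor (u i) (x i)
      simp only [dual, hF, complement, Bool.xor_not, this, Bool.not_not]
    obtain ⟨σ, hσ⟩ := hsort (chow F)
    have hchow : chow (permute σ⁻¹ F) = chow F ∘ σ := by
      funext i
      rw [chow_permute, inv_inv, Function.comp_apply]
    rw [← hchow] at hσ
    refine ⟨permute σ⁻¹ F, ⟨(hG _).2 ⟨⟨(hu.permute _).isLTF, hu.permute _, hFsd.permute _,
      hP _ hσ⟩, hσ⟩, ?_⟩, ?_⟩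
    · exact (((sameSDClass_selfDualLift false h).trans (sameSDClass_complement u _)).trans
        (sameSDClass_permute _ _)).symm
    · rintro g ⟨hgG, hgh⟩
      obtain ⟨⟨hglin, hgpos, hgsd, -⟩, hgP⟩ := (hG g).1 hgG
      have hclass : SameSDClass (permute σ⁻¹ F) g :=
        (((sameSDClass_selfDualLift false h).trans (sameSDClass_complement u _)).trans
          (sameSDClass_permute _ _)).symm.trans hgh.symm
      obtain ⟨τ, rfl⟩ := hclass.exists_permute_eq (hu.permute _) hgpos (hFsd.permute _) hgsd
      refine (permute_eq_iff (hu.permute _).isLTF (hFsd.permute _) (hFsd.permute _) τ).2 ?_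
      have hchow' : chow (permute τ (permute σ⁻¹ F)) = chow (permute σ⁻¹ F) ∘ ⇑τ⁻¹ := by
        funext i
        rw [chow_permute, Function.comp_apply]
      rw [hchow'] at hgP
      have := huniq _ _ hσ hgP
      intro i
      have := congrFun this (τ i)
      simpa using this.symm

theorem isGeneratorEnumeration_monotoneGenerators (n : ℕ) :
    IsGeneratorEnumeration n (monotoneGenerators n) :=
  isGeneratorEnumeration_of_sort (P := Monotone) (fun _ => Or.inl)
    (fun a => ⟨Tuple.sort a, Tuple.monotone_sort a⟩)
    (fun a σ h1 h2 => Tuple.unique_monotone (τ := 1) h2 h1)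
    (fun f => by simp [monotoneGenerators])

theorem isGeneratorEnumeration_antitoneGenerators (n : ℕ) :
    IsGeneratorEnumeration n (antitoneGenerators n) :=
  isGeneratorEnumeration_of_sort (P := Antitone) (fun _ => Or.inr)
    (fun a => ⟨Fin.revPerm.trans (Tuple.sort a),
      (Tuple.monotone_sort a).comp_antitone Fin.rev_anti⟩)
    (fun a σ h1 h2 => Tuple.unique_antitone (τ := 1) h2 h1)
    (fun f => by simp [antitoneGenerators])

/-! ### Counting by means of the generators -/

/-- In every block of equal entries there is a new index, namely the first one. -/
lemma exists_isNew (a : Fin (n + 1) → ℕ) (i : Fin (n + 1)) : ∃ j, a j = a i ∧ IsNew a j := by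
  obtain ⟨j, hj, hmin⟩ := (Finset.univ.filter fun j => a j = a i).exists_minimal
    ⟨i, by simp⟩
  have hj : a j = a i := by simpa using hj
  refine ⟨j, hj, fun k hk h => ?_⟩
  have := hmin (by simp [← h, hj] : k ∈ Finset.univ.filter fun j => a j = a i)
    (Fin.le_def.2 (by omega))
  have := Fin.le_def.1 this
  omega

lemma eq_of_isNew {a : Fin (n + 1) → ℕ} (ha : Monotone a ∨ Antitone a) {i j : Fin (n + 1)}
    (hi : IsNew a i) (hj : IsNew a j) (h : a i = a j) : i = j := by
  wlog hij : i < j generalizing i j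
  · rcases (not_lt.1 hij).eq_or_lt with h' | h'
    · exact h'.symm
    · exact (this hj hi h.symm h').symm
  have hlt := Fin.lt_def.1 hij
  let k : Fin (n + 1) := ⟨j - 1, by omega⟩
  have hik : i ≤ k := Fin.le_def.2 (by simp only [k]; omega)
  have hkj : k ≤ j := Fin.le_def.2 (by simp only [k]; omega)
  refine absurd ?_ (hj k (by simp only [k]; omega))
  rcases ha with ha | ha
  · exact le_antisymm (h ▸ ha hik) (ha hkj)
  · exact le_antisymm (ha hkj) (h ▸ ha hik)

lemma IsSelfDual.exists_permute_eq_of_reduction {f g : BoolFn (n + 1)} (hf : IsSelfDual f)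
    (hg : IsSelfDual g) {i k : Fin (n + 1)} {s : Bool} {τ : Equiv.Perm (Fin n)}
    (h : permute τ (reduction f i s) = reduction g k s) : ∃ σ, σ i = k ∧ permute σ f = g := by
  obtain ⟨σ, hi, hσ⟩ := exists_perm_extend τ i k
  exact ⟨σ, hi, (hf.permute σ).eq_of_reduction_eq hg (by rw [reduction_permute hi hσ, h])⟩

open Classical in
/-- The central count. Let `X` be a set of functions of `n` variables which is closed under
permutations of the arguments, and whose self-dual lifts at `x₀ = s` are positive. Each orbit in `X`
contains reductions `f_{x_i = s}` for exactly one generator `f` and one new index `i`. -/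
theorem ncard_eq_sum_permCount {G : Finset (BoolFn (n + 1))} (hG : IsGeneratorEnumeration n G)
    (s : Bool) {X : Set (BoolFn n)} (hX : ∀ σ h, h ∈ X → permute σ h ∈ X)
    (hpos : ∀ h ∈ X, IsPositive (selfDualLift s h)) :
    X.ncard = ∑ f ∈ G, ∑ i, if IsNew (halfChow f) i ∧ reduction f i s ∈ X then
      permCount (halfChow f) i else 0 := by
  let I : Finset (BoolFn (n + 1) × Fin (n + 1)) := (G ×ˢ Finset.univ).filter fun p =>
    IsNew (halfChow p.1) p.2 ∧ reduction p.1 p.2 s ∈ X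
  let O : BoolFn (n + 1) × Fin (n + 1) → Finset (BoolFn n) := fun p =>
    (Set.range fun σ : Equiv.Perm (Fin n) => permute σ (reduction p.1 p.2 s)).toFinset
  have hmono : ∀ f ∈ G, Monotone (halfChow f) ∨ Antitone (halfChow f) := fun f hf =>
    (hG.canonical f hf).2.2.2.imp
      (fun h i j hij => Nat.div_le_div_right (h hij)) fun h i j hij => Nat.div_le_div_right (h hij)
  have hXO : X.toFinset = I.biUnion O := by
    ext h
    simp only [Set.mem_toFinset, Finset.mem_biUnion, I, O, Finset.mem_filter, Finset.mem_product,
      Finset.mem_univ, and_true, Set.mem_range, Prod.exists]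
    constructor
    · intro hh
      have hlin : IsLTF h := by
        have := ((hpos h hh).reduction 0 s).isLTF
        rwa [reduction_selfDualLift] at this
      obtain ⟨f, ⟨hfG, hfh⟩, -⟩ := hG.existsUnique h hlin
      obtain ⟨-, hfpos, hfsd, -⟩ := hG.canonical f hfG
      have hsd := isSelfDual_selfDualLift s h
      obtain ⟨σ, hσ⟩ := (hfh.trans (sameSDClass_selfDualLift s h)).exists_permute_eq hfpos
        (hpos h hh) hfsd hsd
      -- `x₀` takes the place of the argument `i`, which is exchanged with the new index `k`.
      obtain ⟨k, hk, hknew⟩ := exists_isNew (halfChow f) (σ⁻¹ 0)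
      have hswap : permute (Equiv.swap (σ⁻¹ 0) k) f = f := by
        rw [permute_eq_iff hfpos.isLTF hfsd hfsd]
        rw [hfsd.halfChow_eq_iff hfsd] at hk
        intro i
        rcases eq_or_ne i (σ⁻¹ 0) with rfl | h1
        · rw [Equiv.swap_apply_left, hk]
        rcases eq_or_ne i k with rfl | h2
        · rw [Equiv.swap_apply_right, hk]
        · rw [Equiv.swap_apply_of_ne_of_ne h1 h2]
      rw [← hswap, permute_permute] at hσ
      set ρ := σ * Equiv.swap (σ⁻¹ 0) k
      have hρ : ρ k = 0 := by simp [ρ]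
      obtain ⟨τ, hτ⟩ := exists_perm_succAbove ρ k
      rw [hρ] at hτ
      have hred : permute τ (reduction f k s) = h := by
        rw [← reduction_permute hρ hτ, hσ, reduction_selfDualLift]
      refine ⟨f, k, ⟨hfG, hknew, ?_⟩, τ, hred⟩
      have := hX τ⁻¹ h hh
      rwa [← hred, permute_permute, inv_mul_cancel, permute_one] at this
    · rintro ⟨f, i, ⟨-, -, hX'⟩, σ, rfl⟩
      exact hX σ _ hX'
  have hdisj : (I : Set (BoolFn (n + 1) × Fin (n + 1))).PairwiseDisjoint O := by
    rintro ⟨f, i⟩ hfi ⟨g, k⟩ hgk hne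
    simp only [I, Finset.coe_filter, Finset.mem_product, Finset.mem_univ, and_true,
      Set.mem_ofPred_eq] at hfi hgk
    obtain ⟨hfG, hinew, -⟩ := hfi
    obtain ⟨hgG, hknew, -⟩ := hgk
    obtain ⟨hflin, -, hfsd, -⟩ := hG.canonical f hfG
    obtain ⟨-, -, hgsd, -⟩ := hG.canonical g hgG
    rw [Function.onFun, Finset.disjoint_left]
    intro h hf hg
    refine hne ?_
    simp only [O, Set.mem_toFinset, Set.mem_range] at hf hg
    obtain ⟨τ₁, rfl⟩ := hf
    obtain ⟨τ₂, h₂⟩ := hg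
    have hred : permute (τ₂⁻¹ * τ₁) (reduction f i s) = reduction g k s := by
      rw [← permute_permute, ← h₂, permute_permute, inv_mul_cancel, permute_one]
    obtain ⟨σ, hσi, hσ⟩ := hfsd.exists_permute_eq_of_reduction hgsd hred
    obtain ⟨h₀, hlin, hgh⟩ := hG.meets g hgG
    have hfg : f = g := (hG.existsUnique h₀ hlin).unique
      ⟨hfG, (hσ ▸ sameSDClass_permute σ f).trans hgh⟩ ⟨hgG, hgh⟩
    subst hfg
    have hchow := (permute_eq_iff hflin hfsd hfsd σ).1 hσ i
    rw [hσi, ← hfsd.halfChow_eq_iff hfsd] at hchow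
    rw [eq_of_isNew (hmono f hfG) hinew hknew hchow.symm]
  rw [Set.ncard_eq_toFinset_card', hXO, Finset.card_biUnion hdisj, Finset.sum_filter,
    Finset.sum_product]
  refine Finset.sum_congr rfl fun f hf => Finset.sum_congr rfl fun i _ => ?_
  obtain ⟨hlin, -, hsd, -⟩ := hG.canonical f hf
  rw [permCount_eq hlin hsd i s, Set.ncard_eq_toFinset_card']

lemma IsSemiGoldilocks.permute {h : BoolFn n} (hh : IsSemiGoldilocks h)
    (σ : Equiv.Perm (Fin n)) : IsSemiGoldilocks (permute σ h) :=
  ⟨(hh.2.1.permute σ).isLTF, hh.2.1.permute σ, hh.2.2.permute σ⟩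

lemma isSemiGoldilocks_reduction_iff {f : BoolFn (n + 1)} (hf : IsPositive f) (i : Fin (n + 1))
    (s : Bool) : IsSemiGoldilocks (reduction f i s) ↔ isSmallTest f i s = true := by
  rw [isSmallTest_iff hf]
  exact ⟨fun h => h.2.2, fun h => ⟨(hf.reduction i s).isLTF, hf.reduction i s, h⟩⟩

theorem numGoldilocks_eq {G : Finset (BoolFn (n + 1))} (hG : IsGeneratorEnumeration n G) :
    numGoldilocks n = ∑ f ∈ G, ∑ i, if IsNew (halfChow f) i ∧ isSmallTest f i true = true then
      permCount (halfChow f) i else 0 := by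
  classical
  rw [numGoldilocks, ncard_eq_sum_permCount hG true (X := {h | IsGoldilocks h})
    (fun σ h hh => ⟨hh.1.permute σ, hh.2.permute σ⟩)
    fun h hh => hh.2.isPositive_selfDualLift hh.1.2.1]
  refine Finset.sum_congr rfl fun f hf => Finset.sum_congr rfl fun i _ => ?_
  obtain ⟨-, hpos, hsd, -⟩ := hG.canonical f hf
  have : reduction f i true ∈ {h | IsGoldilocks h} ↔ isSmallTest f i true = true := by
    rw [← isSemiGoldilocks_reduction_iff hpos]
    exact ⟨fun h => h.1, fun h => ⟨h, hpos.isAmple_reduction_true hsd i⟩⟩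
  simp only [this]

theorem sum_goldSD_eq {G : Finset (BoolFn (n + 1))} (hG : IsGeneratorEnumeration n G) :
    ∑ f ∈ G, goldSD f (halfChow f) = numGoldilocks n := by
  rw [numGoldilocks_eq hG]
  refine Finset.sum_congr rfl fun f hf => Finset.sum_congr rfl fun i _ => ?_
  obtain ⟨-, hpos, hsd, -⟩ := hG.canonical f hf
  have : isSmallTest f i (decide (2 ^ n < 2 * halfChow f i)) = isSmallTest f i true := by
    by_cases h : 2 ^ n < 2 * halfChow f i
    · rw [decide_eq_true h]
    · have hred := (hpos.two_mul_halfChow_eq_iff hsd i).1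
        (le_antisymm (not_lt.1 h) (hpos.two_pow_le hsd i))
      rw [decide_eq_false h, isSmallTest, isSmallTest, hred]
  rw [this, ite_and]

/-- The non-ample Semi-Goldilocks functions are the reductions at `x_i = 0`, for the arguments on
which the generator depends. -/
theorem ncard_not_isAmple_eq {G : Finset (BoolFn (n + 1))} (hG : IsGeneratorEnumeration n G) :
    {h : BoolFn n | IsSemiGoldilocks h ∧ ¬ IsAmple h}.ncard =
      ∑ f ∈ G, ∑ i, if IsNew (halfChow f) i ∧
        (isSmallTest f i false = true ∧ 2 * halfChow f i ≠ 2 ^ n) then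
      permCount (halfChow f) i else 0 := by
  classical
  rw [ncard_eq_sum_permCount hG false (X := {h | IsSemiGoldilocks h ∧ ¬ IsAmple h})
    (fun σ h hh => ⟨hh.1.permute σ, fun ha => hh.2 ?_⟩)
    fun h hh => hh.1.2.1.isPositive_selfDualLift hh.2]
  · refine Finset.sum_congr rfl fun f hf => Finset.sum_congr rfl fun i _ => ?_
    obtain ⟨-, hpos, hsd, -⟩ := hG.canonical f hf
    have : reduction f i false ∈ {h | IsSemiGoldilocks h ∧ ¬ IsAmple h} ↔
        isSmallTest f i false = true ∧ 2 * halfChow f i ≠ 2 ^ n := by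
      rw [Set.mem_ofPred_eq, isSemiGoldilocks_reduction_iff hpos,
        hpos.isAmple_reduction_false_iff hsd, ne_eq, hpos.two_mul_halfChow_eq_iff hsd]
    simp only [this]
  · have := ha.permute σ⁻¹
    rwa [permute_permute, inv_mul_cancel, permute_one] at this

theorem sum_sGoldSD_eq {G : Finset (BoolFn (n + 1))} (hG : IsGeneratorEnumeration n G) :
    ∑ f ∈ G, sGoldSD f (halfChow f) = numSemiGoldilocks n := by
  have hunion : {h : BoolFn n | IsSemiGoldilocks h} =
      {h | IsGoldilocks h} ∪ {h | IsSemiGoldilocks h ∧ ¬ IsAmple h} := by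
    ext h
    simp only [IsGoldilocks, Set.mem_ofPred_eq, Set.mem_union]
    tauto
  have hdisj : Disjoint {h : BoolFn n | IsGoldilocks h}
      {h | IsSemiGoldilocks h ∧ ¬ IsAmple h} :=
    Set.disjoint_left.2 fun h h1 h2 => h2.2 h1.2
  rw [numSemiGoldilocks, hunion, Set.ncard_union_eq hdisj (Set.toFinite _) (Set.toFinite _),
    ncard_not_isAmple_eq hG, ← numGoldilocks, numGoldilocks_eq hG, ← Finset.sum_add_distrib]
  refine Finset.sum_congr rfl fun f _ => ?_
  rw [sGoldSD, ← Finset.sum_add_distrib]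
  refine Finset.sum_congr rfl fun i _ => ?_
  by_cases h : IsNew (halfChow f) i <;> simp only [h, if_true, if_false, true_and, false_and,
    add_zero]

/-! ### Chambers -/

/-- The scalar product of a real weight vector with a boolean vector. -/
def realDot (w : Fin n → ℝ) (x : Fin n → Bool) : ℝ := ∑ i, w i * (if x i then 1 else 0)

/-- The threshold function of a real weight vector, with threshold `1`. -/
noncomputable def thresholdFn (w : Fin n → ℝ) : BoolFn n := fun x => decide (1 < realDot w x)

/-- The part of `𝓓_{g,n}` off the walls on which the threshold function is `f`. -/
def chamber (g : ℕ) (f : BoolFn n) : Set (Fin n → ℝ) :=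
  {w | w ∈ admissibleWeights g n ∧ ∀ x, if f x = true then 1 < realDot w x else realDot w x < 1}

lemma continuous_realDot (x : Fin n → Bool) : Continuous fun w => realDot w x := by
  unfold realDot
  fun_prop

lemma realDot_cast (q : Fin n → ℚ) (x : Fin n → Bool) :
    realDot (fun i => (q i : ℝ)) x = (dot q x : ℚ) := by
  rw [realDot, dot, Rat.cast_sum]
  refine Finset.sum_congr rfl fun i _ => ?_
  split_ifs <;> simp

lemma realDot_indicator (w : Fin n → ℝ) (S : Finset (Fin n)) :
    realDot w (fun i => decide (i ∈ S)) = ∑ i ∈ S, w i := by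
  simp [realDot]

lemma realDot_single (w : Fin n → ℝ) (j : Fin n) : realDot w (fun k => decide (k = j)) = w j := by
  simp [realDot]

lemma realDot_ne_one_iff {w : Fin n → ℝ} : (∀ x, realDot w x ≠ 1) ↔ w ∉ walls n := by
  constructor
  · rintro h ⟨S, -, hS⟩
    exact h _ ((realDot_indicator w S).trans hS)
  · intro h x hx
    have hsum : ∑ i ∈ Finset.univ.filter (fun i => x i = true), w i = 1 := by
      rw [← hx, realDot, Finset.sum_filter]
      simp
    refine h ⟨_, Finset.nonempty_iff_ne_empty.2 fun hS => ?_, hsum⟩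
    rw [hS] at hsum
    simp at hsum

lemma mem_chamber_iff {g : ℕ} {f : BoolFn n} {w : Fin n → ℝ} :
    w ∈ chamber g f ↔ w ∈ admissibleWeights g n \ walls n ∧ thresholdFn w = f := by
  rw [chamber, Set.mem_ofPred_eq, Set.mem_sdiff, ← realDot_ne_one_iff, and_assoc]
  refine and_congr_right fun _ => ?_
  constructor
  · intro h
    refine ⟨fun x hx => ?_, funext fun x => ?_⟩
    · have := h x
      rw [hx] at this
      split_ifs at this <;> exact lt_irrefl _ this
    · have := h x
      rw [thresholdFn]
      cases hfx : f x
      · rw [if_neg (by simp [hfx])] at this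
        exact decide_eq_false this.not_gt
      · rw [if_pos hfx] at this
        exact decide_eq_true this
  · rintro ⟨hne, rfl⟩ x
    simp only [thresholdFn, decide_eq_true_eq]
    split_ifs with h
    · exact h
    · exact lt_of_le_of_ne (not_lt.1 h) (hne x)

lemma convex_chamber (g : ℕ) (f : BoolFn n) : Convex ℝ (chamber g f) := by
  intro v hv w hw a b ha hb hab
  have hdot : ∀ x, realDot (a • v + b • w) x = a • realDot v x + b • realDot w x := fun x => by
    simp only [realDot, Pi.add_apply, Pi.smul_apply, smul_eq_mul, Finset.mul_sum,
      ← Finset.sum_add_distrib]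
    exact Finset.sum_congr rfl fun i _ => by ring
  refine ⟨⟨fun j => convex_Ioc (0 : ℝ) 1 (hv.1.1 j) (hw.1.1 j) ha hb hab, ?_⟩, fun x => ?_⟩
  · have := convex_Ioi (2 - 2 * (g : ℝ)) hv.1.2 hw.1.2 ha hb hab
    simp only [Pi.add_apply, Pi.smul_apply, smul_eq_mul, Finset.sum_add_distrib,
      ← Finset.mul_sum]
    exact this
  · have h1 := hv.2 x
    have h2 := hw.2 x
    rw [hdot]
    split_ifs at h1 h2 ⊢
    · exact convex_Ioi (1 : ℝ) h1 h2 ha hb hab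
    · exact convex_Iio (1 : ℝ) h1 h2 ha hb hab

/-- Off the walls the threshold function is locally constant, and the sets on which it takes a
given value are convex. So the chambers correspond to the values. -/
lemma numChambers_eq_ncard (g n : ℕ) :
    numChambers g n = {f : BoolFn n | (chamber g f).Nonempty}.ncard := by
  let U : Set (Fin n → ℝ) := admissibleWeights g n \ walls n
  let φ : U → BoolFn n := fun w => thresholdFn w.1
  have hφ : Continuous φ := by
    refine continuous_pi fun x => (continuous_bool_rng true).2 ⟨?_, ?_⟩
    · have : (fun w : U => φ w x) ⁻¹' {true} = {w : U | 1 ≤ realDot w.1 x} := by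
        ext w
        have := realDot_ne_one_iff.2 w.2.2 x
        simp only [φ, thresholdFn, Set.mem_preimage, Set.mem_singleton_iff, decide_eq_true_eq,
          Set.mem_ofPred_eq]
        exact ⟨le_of_lt, fun h => lt_of_le_of_ne h this.symm⟩
      rw [this]
      exact isClosed_le continuous_const ((continuous_realDot x).comp continuous_subtype_val)
    · have : (fun w : U => φ w x) ⁻¹' {true} = {w : U | 1 < realDot w.1 x} := by
        ext w
        simp [φ, thresholdFn]
      rw [this]
      exact isOpen_lt continuous_const ((continuous_realDot x).comp continuous_subtype_val)
  have hinj : Function.Injective hφ.connectedComponentsLift := by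
    intro p q
    obtain ⟨v, rfl⟩ := ConnectedComponents.surjective_coe p
    obtain ⟨w, rfl⟩ := ConnectedComponents.surjective_coe q
    rw [hφ.connectedComponentsLift_apply_coe, hφ.connectedComponentsLift_apply_coe]
    intro h
    have hfib : Subtype.val '' {u : U | φ u = φ w} = chamber g (φ w) := by
      ext u
      rw [mem_chamber_iff]
      constructor
      · rintro ⟨u, hu, rfl⟩
        exact ⟨u.2, hu⟩
      · rintro ⟨hu, hφu⟩
        exact ⟨⟨u, hu⟩, hφu, rfl⟩
    have hpre : IsPreconnected {u : U | φ u = φ w} := by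
      rw [← IsInducing.subtypeVal.isPreconnected_image, hfib]
      exact (convex_chamber g _).isPreconnected
    exact ConnectedComponents.coe_eq_coe'.2 (hpre.subset_connectedComponent rfl h)
  have hrange : Set.range hφ.connectedComponentsLift = {f | (chamber g f).Nonempty} := by
    rw [← ConnectedComponents.surjective_coe.range_comp, hφ.connectedComponentsLift_comp_coe]
    ext f
    simp only [Set.mem_range, Set.mem_ofPred_eq, Set.Nonempty, mem_chamber_iff]
    constructor
    · rintro ⟨w, hw⟩
      exact ⟨w.1, w.2, hw⟩
    · rintro ⟨w, hw, h⟩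
      exact ⟨⟨w, hw⟩, h⟩
  rw [← hrange, ← Nat.card_coe_set_eq, Nat.card_range_of_injective hinj]
  rfl

/-- A nonempty chamber contains weights close to rational ones, which realize the function. -/
lemma exists_realizes_of_chamber_nonempty {g : ℕ} {f : BoolFn n} (h : (chamber g f).Nonempty) :
    ∃ q : Fin n → ℚ, Realizes q 1 f ∧ (∀ j, 0 < q j) ∧ 2 - 2 * (g : ℚ) < ∑ j, q j := by
  obtain ⟨w, ⟨hw1, hw2⟩, hw3⟩ := h
  let V : Set (Fin n → ℝ) := {v | (∀ j, 0 < v j) ∧ 2 - 2 * (g : ℝ) < ∑ j, v j ∧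
    ∀ x, if f x = true then 1 < realDot v x else realDot v x < 1}
  have hV : IsOpen V := by
    refine IsOpen.and ?_ (IsOpen.and ?_ ?_)
    · simp only [Set.ofPred_forall]
      exact isOpen_iInter_of_finite fun j => isOpen_lt continuous_const (continuous_apply j)
    · exact isOpen_lt continuous_const (by fun_prop)
    · simp only [Set.ofPred_forall]
      refine isOpen_iInter_of_finite fun x => ?_
      by_cases hx : f x = true
      · simp only [hx, if_true]
        exact isOpen_lt continuous_const (continuous_realDot x)
      · simp only [hx]
        exact isOpen_lt (continuous_realDot x) continuous_const
  have hdense : DenseRange (Pi.map fun (_ : Fin n) (q : ℚ) => (q : ℝ)) :=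
    DenseRange.piMap fun _ => Rat.denseRange_cast
  obtain ⟨q, hq1, hq2, hq3⟩ := hdense.exists_mem_open hV ⟨w, fun j => (hw1 j).1, hw2, hw3⟩
  refine ⟨q, realizes_iff.2 fun x => ?_, fun j => by simpa using hq1 j, ?_⟩
  · have := hq3 x
    rw [show Pi.map (fun (_ : Fin n) (q : ℚ) => (q : ℝ)) q = fun i => (q i : ℝ) from rfl,
      realDot_cast] at this
    split_ifs at this with hx
    · exact ⟨fun _ => by exact_mod_cast this, fun _ => hx⟩
    · exact ⟨fun h => absurd h hx, fun h => absurd this (by exact_mod_cast h.le.not_gt)⟩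
  · have : 2 - 2 * (g : ℝ) < ∑ j, (q j : ℝ) := hq2
    exact_mod_cast this

lemma isSemiGoldilocks_of_chamber_nonempty {g : ℕ} {f : BoolFn n} (h : (chamber g f).Nonempty) :
    IsSemiGoldilocks f := by
  obtain ⟨q, hq, hpos, -⟩ := exists_realizes_of_chamber_nonempty h
  have hf : IsPositive f := ⟨q, 1, hq, hpos⟩
  refine ⟨hf.isLTF, hf, (isSmall_iff hf).2 fun j => ?_⟩
  obtain ⟨w, hw1, hw2⟩ := h
  have := hw2 fun k => decide (k = j)
  rw [realDot_single] at this
  by_contra hj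
  rw [if_pos (Bool.not_eq_false _ ▸ hj)] at this
  exact this.not_ge (hw1.1 j).2

/-- Weights which realize a small function are scaled such that the threshold becomes `1`. -/
lemma Realizes.mem_chamber {g : ℕ} {f : BoolFn n} {w : Fin n → ℚ} {θ : ℚ} (h : Realizes w θ f)
    (hne : ∀ x, dot w x ≠ θ) (hw : ∀ j, 0 < w j) (hwθ : ∀ j, w j ≤ θ) (hθ : 0 < θ)
    (hsum : (2 - 2 * (g : ℚ)) * θ < ∑ j, w j) :
    (fun j => ((w j / θ : ℚ) : ℝ)) ∈ chamber g f := by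
  have hdot : ∀ x, dot (fun j => w j / θ) x = dot w x / θ := fun x => by
    simp only [dot, Finset.sum_div, div_mul_eq_mul_div]
  rw [realizes_iff] at h
  refine ⟨⟨fun j => ⟨?_, ?_⟩, ?_⟩, fun x => ?_⟩
  · exact Rat.cast_pos.2 (div_pos (hw j) hθ)
  · rw [← Rat.cast_one]
    exact Rat.cast_le.2 ((div_le_one hθ).2 (hwθ j))
  · have : 2 - 2 * (g : ℚ) < ∑ j, w j / θ := by
      rwa [← Finset.sum_div, lt_div_iff₀ hθ]
    have := (Rat.cast_lt (K := ℝ)).2 this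
    rw [Rat.cast_sum] at this
    simpa using this
  · rw [realDot_cast, hdot]
    split_ifs with hx
    · exact_mod_cast (one_lt_div hθ).2 ((h x).1 hx)
    · exact_mod_cast (div_lt_one hθ).2 (lt_of_le_of_ne (not_lt.1 (mt (h x).2 hx)) (hne x))

lemma IsSmall.le_of_realizes {f : BoolFn n} (hs : IsSmall f) {w : Fin n → ℚ} {θ : ℚ}
    (h : Realizes w θ f) (hw : ∀ j, 0 < w j) (j : Fin n) : w j ≤ θ := by
  have := (isSmall_iff ⟨w, θ, h, hw⟩).1 hs j
  rw [← Bool.not_eq_true, realizes_iff.1 h, dot_single] at this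
  exact not_lt.1 this

theorem numChambers_eq_numSemiGoldilocks (hn : 1 ≤ n) {g : ℕ} (hg : 1 ≤ g) :
    numChambers g n = numSemiGoldilocks n := by
  rw [numChambers_eq_ncard, numSemiGoldilocks]
  congr 1
  ext f
  refine ⟨isSemiGoldilocks_of_chamber_nonempty, ?_⟩
  rintro ⟨-, ⟨w, θ, h, hw⟩, hs⟩
  have hle := hs.le_of_realizes h hw
  have hθ : 0 < θ := (hw ⟨0, hn⟩).trans_le (hle _)
  obtain ⟨θ', hlt, -, h', hne⟩ := h.exists_strict (lt_add_one θ)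
  refine ⟨_, h'.mem_chamber hne hw (fun j => (hle j).trans hlt.le) (hθ.trans hlt) ?_⟩
  have hpos : 0 < ∑ j, w j := Finset.sum_pos (fun j _ => hw j) ⟨⟨0, hn⟩, Finset.mem_univ _⟩
  have hg' : (1 : ℚ) ≤ g := by exact_mod_cast hg
  exact (mul_nonpos_of_nonpos_of_nonneg (by linarith) (hθ.trans hlt).le).trans_lt hpos

theorem numChambers_zero_eq_numGoldilocks (hn : 1 ≤ n) : numChambers 0 n = numGoldilocks n := by
  rw [numChambers_eq_ncard, numGoldilocks]
  congr 1
  ext f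
  constructor
  · intro h
    obtain ⟨q, hq, -, hsum⟩ := exists_realizes_of_chamber_nonempty h
    exact ⟨isSemiGoldilocks_of_chamber_nonempty h, q, 1, hq, by simpa using hsum⟩
  · rintro ⟨⟨-, hpos, hs⟩, ha⟩
    obtain ⟨w, θ, h, hw, hsum⟩ := ha.exists_realizes hpos
    have hle := hs.le_of_realizes h hw
    have hθ : 0 < θ := (hw ⟨0, hn⟩).trans_le (hle _)
    obtain ⟨θ', hlt, hlt', h', hne⟩ := h.exists_strict (show θ < (∑ j, w j) / 2 by linarith)
    refine ⟨_, h'.mem_chamber hne hw (fun j => (hle j).trans hlt.le) (hθ.trans hlt) ?_⟩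
    simp only [Nat.cast_zero]
    linarith

end LTF

open LTF
theorem mainTheorem9 (n : ℕ) :
    IsGeneratorEnumeration n (monotoneGenerators n) ∧
    IsGeneratorEnumeration n (antitoneGenerators n) ∧
    ∀ G : Finset (BoolFn (n + 1)), IsGeneratorEnumeration n G →
      (∀ f ∈ G, chowZero f = 2 ^ n ∧ ∀ i, chow f i = 2 * halfChow f i) ∧
      (∀ f ∈ G, ∀ (i : Fin (n + 1)) (s : Bool),
        (isSmallTest f i s = true ↔ IsSmall (reduction f i s)) ∧
        permCount (halfChow f) i =
          (Set.range fun σ : Equiv.Perm (Fin n) => permute σ (reduction f i s)).ncard) ∧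
      ∑ f ∈ G, sGoldSD f (halfChow f) = numSemiGoldilocks n ∧
      ∑ f ∈ G, goldSD f (halfChow f) = numGoldilocks n ∧
      (1 ≤ n →
        (∀ g : ℕ, 1 ≤ g → ∑ f ∈ G, sGoldSD f (halfChow f) = numChambers g n) ∧
        ∑ f ∈ G, goldSD f (halfChow f) = numChambers 0 n) := by
  refine ⟨isGeneratorEnumeration_monotoneGenerators n, isGeneratorEnumeration_antitoneGenerators n,
    fun G hG => ⟨fun f hf => ?_, fun f hf i s => ?_, sum_sGoldSD_eq hG, sum_goldSD_eq hG,
      fun hn => ⟨fun g hg => ?_, ?_⟩⟩⟩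
  · obtain ⟨-, -, hsd, -⟩ := hG.canonical f hf
    exact ⟨hsd.chowZero_eq, hsd.chow_eq_two_mul⟩
  · obtain ⟨hlin, hpos, hsd, -⟩ := hG.canonical f hf
    exact ⟨isSmallTest_iff hpos i s, permCount_eq hlin hsd i s⟩
  · rw [sum_sGoldSD_eq hG, numChambers_eq_numSemiGoldilocks hn hg]
  · rw [sum_goldSD_eq hG, numChambers_zero_eq_numGoldilocks hn]
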